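/- **Notation.** Let $C[0,1]^d$ be the space of continuous functions $f:[0,1]^d\to\mathbb R$, with graph $G_f=\{(x,f(x)):x\in[0,1]^d\}\subset\mathbb R^{d+1}$. For $f\in C[0,1]^2$ the horizon $H(f)\in C[0,1]$ is $H(f)(x)=\sup_{y\in[0,1]}f(x,y)$. For a bounded set $F\subset\mathbb R^n$ let $N_\delta(F)$ be the number of closed cubes of the $\delta$-mesh $\{\prod_i[m_i\delta,(m_i+1)\delta]:m\in\mathbb Z^n\}$ that meet $F$; the lower and upper box dimensions $\underline{\dim}_B F$ and $\overline{\dim}_B F$ are the lower and upper limits of $\log N_\delta(F)/(-\log\delta)$ as $\delta\to0^+$, and $\dim_B F=\alpha$ means that both are equal to $\alpha$. For $\alpha\in[2,3)$ let $C_\alpha[0,1]^2=\{f\in C[0,1]^2:\overline{\dim}_B G_f\le\alpha\}$, which is a vector space, with the metric $$d_{\alpha,2}(f,g)=\sum_{k=1}^\infty\min\{2^{-k},\|f-g\|_{\alpha+1/k,2}\},\qquad \|f\|_{\beta,2}=\|f\|_\infty+\sup_{0<\delta\le1}\frac{\sum_{S\in\Delta_\delta}R_f(S)}{\delta^{1-\beta}},$$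 where $\Delta_\delta$ is the set of the squares $[n_1\delta,(n_1+1)\delta]\times[n_2\delta,(n_2+1)\delta]$ with $0\le n_1,n_2\le\lceil\delta^{-1}\rceil-1$ and $R_f(S)=\sup_{x,y\in S\cap[0,1]^2}|f(x)-f(y)|$. A subset $F$ of a completely metrizable topological vector space $X$ is prevalent if it is Borel and there are a Borel measure $\mu$ on $X$ and a compact set $K\subseteq X$ with $0<\mu(K)<\infty$ such that $\mu(X\setminus(F+x))=0$ for all $x\in X$. **Theorem.** Let $\alpha\in[2,3)$ and let $$U_\alpha[0,1]^2=\{f\in C_\alpha[0,1]^2:\dim_B G_f=\alpha\text{ and }\alpha-1\le\underline{\dim}_B G_{H(f)}\le\overline{\dim}_B G_{H(f)}<2\},$$ $$L_\alpha[0,1]^2=\{f\in C_\alpha[0,1]^2:\dim_B G_f=\alpha\text{ and }\alpha-1<\underline{\dim}_B G_{H(f)}\le\overline{\dim}_B G_{H(f)}\le2\}.$$ Then 1. $U_\alpha[0,1]^2$ is not a prevalent subset of $(C_\alpha[0,1]^2,d_{\alpha,2})$; 2. $L_\alpha[0,1]^2$ is not a prevalent subset of $(C_\alpha[0,1]^2,d_{\alpha,2})$.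 -/

import Mathlib

open Filter Topology MeasureTheory
open scoped ENNReal unitInterval

noncomputable section

namespace Horizon

/-! ### Box dimension -/

/-- The closed cube of the `δ`-mesh in `ℝⁿ` with lower corner `δ • m`. -/
def meshCube {n : ℕ} (δ : ℝ) (m : Fin n → ℤ) : Set (Fin n → ℝ) :=
  {p | ∀ i, (m i : ℝ) * δ ≤ p i ∧ p i ≤ ((m i : ℝ) + 1) * δ}

/-- The index set of the cubes of the `δ`-mesh that meet `F`. -/
def hitCubes {n : ℕ} (δ : ℝ) (F : Set (Fin n → ℝ)) : Set (Fin n → ℤ) :=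
  {m | (meshCube δ m ∩ F).Nonempty}

/-- `N_δ(F)`, the number of cubes of the `δ`-mesh that meet the bounded set `F`. -/
def boxCount {n : ℕ} (δ : ℝ) (F : Set (Fin n → ℝ)) : ℕ := (hitCubes δ F).ncard

/-- Lower box dimension of a bounded set. -/
def lowerBoxDim {n : ℕ} (F : Set (Fin n → ℝ)) : EReal :=
  liminf (fun δ : ℝ => ((Real.log (boxCount δ F) / -Real.log δ : ℝ) : EReal)) (𝓝[>] 0)

/-- Upper box dimension of a bounded set. -/
def upperBoxDim {n : ℕ} (F : Set (Fin n → ℝ)) : EReal :=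
  limsup (fun δ : ℝ => ((Real.log (boxCount δ F) / -Real.log δ : ℝ) : EReal)) (𝓝[>] 0)

/-- The graph of a function on `[0,1]^d`, as a subset of `ℝ^(d+1)`. -/
def graph {d : ℕ} (f : (Fin d → I) → ℝ) : Set (Fin (d + 1) → ℝ) :=
  Set.range fun x : Fin d → I => Fin.snoc (α := fun _ => ℝ) (fun i => (x i : ℝ)) (f x)

/-- The horizon `H(f)(x) = sup_{y ∈ [0,1]} f(x, y)` of a function on `[0,1]²`. -/
def horizon (f : (Fin 2 → I) → ℝ) : (Fin 1 → I) → ℝ := fun x => ⨆ y : I, f ![x 0, y]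

/-! ### The functions whose graph has upper box dimension at most `α` form a vector space -/

theorem mem_hitCubes_graph {d : ℕ} {δ : ℝ} {f : (Fin d → I) → ℝ} {m : Fin (d + 1) → ℤ} :
    m ∈ hitCubes δ (graph f) ↔ ∃ x : Fin d → I,
      (∀ i : Fin d, (m i.castSucc : ℝ) * δ ≤ x i ∧ (x i : ℝ) ≤ ((m i.castSucc : ℝ) + 1) * δ) ∧
      (m (Fin.last d) : ℝ) * δ ≤ f x ∧ f x ≤ ((m (Fin.last d) : ℝ) + 1) * δ := by
  constructor
  · rintro ⟨p, hp, x, rfl⟩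
    refine ⟨x, fun i => ?_, ?_⟩
    · simpa using hp i.castSucc
    · simpa using hp (Fin.last d)
  · rintro ⟨x, h1, h2⟩
    refine ⟨_, fun i => ?_, x, rfl⟩
    induction i using Fin.lastCases with
    | last => simpa using h2
    | cast i => simpa using h1 i

theorem finite_hitCubes {d : ℕ} {δ : ℝ} (hδ : 0 < δ) (f : C(Fin d → I, ℝ)) :
    (hitCubes δ (graph f)).Finite := by
  have key : ∀ (B v : ℝ) (k : ℤ), |v| ≤ B → (k : ℝ) * δ ≤ v → v ≤ ((k : ℝ) + 1) * δ →
      ⌊-B / δ⌋ - 1 ≤ k ∧ k ≤ ⌊B / δ⌋ := by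
    intro B v k hv h1 h2
    rw [abs_le] at hv
    constructor
    · have h3 : -B / δ ≤ (k : ℝ) + 1 := by
        rw [div_le_iff₀ hδ]; linarith
      have h4 : ((⌊-B / δ⌋ : ℤ) : ℝ) ≤ ((k + 1 : ℤ) : ℝ) := by
        push_cast; exact (Int.floor_le _).trans h3
      have := Int.cast_le.1 h4
      omega
    · rw [Int.le_floor, le_div_iff₀ hδ]; linarith
  set B : ℝ := max 1 ‖f‖
  refine (Set.finite_Icc (fun _ : Fin (d + 1) => ⌊-B / δ⌋ - 1) (fun _ => ⌊B / δ⌋)).subset ?_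
  intro m hm
  obtain ⟨x, h1, h2, h3⟩ := mem_hitCubes_graph.1 hm
  have hall : ∀ i, ⌊-B / δ⌋ - 1 ≤ m i ∧ m i ≤ ⌊B / δ⌋ := by
    intro i
    induction i using Fin.lastCases with
    | last =>
      exact key B (f x) _ ((f.norm_coe_le_norm x).trans (le_max_right _ _)) h2 h3
    | cast i =>
      refine key B (x i) _ ?_ (h1 i).1 (h1 i).2
      rw [abs_of_nonneg (x i).2.1]
      exact (x i).2.2.trans (le_max_left _ _)
  exact ⟨fun i => (hall i).1, fun i => (hall i).2⟩

/-- The part of the mesh cube `n` that lies in `[0,1]^d`. -/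
def gridCell {d : ℕ} (δ : ℝ) (n : Fin d → ℤ) : Set (Fin d → I) :=
  {x | ∀ i, (n i : ℝ) * δ ≤ x i ∧ (x i : ℝ) ≤ ((n i : ℝ) + 1) * δ}

theorem isPreconnected_gridCell {d : ℕ} (δ : ℝ) (n : Fin d → ℤ) :
    IsPreconnected (gridCell δ n) := by
  have : gridCell δ n =
      Set.pi Set.univ fun i => {t : I | (n i : ℝ) * δ ≤ t ∧ (t : ℝ) ≤ ((n i : ℝ) + 1) * δ} := by
    ext x; simp [gridCell]
  rw [this]
  refine isPreconnected_univ_pi fun i => ?_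
  refine Set.OrdConnected.isPreconnected ⟨?_⟩
  rintro a ⟨ha, _⟩ b ⟨_, hb⟩ c ⟨hac, hcb⟩
  have h1 : (a : ℝ) ≤ c := hac
  have h2 : (c : ℝ) ≤ b := hcb
  exact ⟨ha.trans h1, h2.trans hb⟩

/-- The part of `hitCubes δ (graph f)` above the grid cell `n`. -/
def column {d : ℕ} (δ : ℝ) (f : (Fin d → I) → ℝ) (n : Fin d → ℤ) : Set ℤ :=
  {j | ∃ x ∈ gridCell δ n, (j : ℝ) * δ ≤ f x ∧ f x ≤ ((j : ℝ) + 1) * δ}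

theorem mem_hitCubes_iff_column {d : ℕ} {δ : ℝ} {f : (Fin d → I) → ℝ} {m : Fin (d + 1) → ℤ} :
    m ∈ hitCubes δ (graph f) ↔ m (Fin.last d) ∈ column δ f (Fin.init m) := by
  rw [mem_hitCubes_graph]; rfl

theorem finite_column {d : ℕ} {δ : ℝ} (hδ : 0 < δ) (f : C(Fin d → I, ℝ)) (n : Fin d → ℤ) :
    (column δ f n).Finite := by
  refine ((finite_hitCubes hδ f).image fun m => m (Fin.last d)).subset fun j hj => ?_
  exact ⟨Fin.snoc (α := fun _ => ℤ) n j, mem_hitCubes_iff_column.2 (by simpa using hj), by simp⟩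

theorem osc_le_column {d : ℕ} {δ : ℝ} (hδ : 0 < δ) (f : C(Fin d → I, ℝ)) (n : Fin d → ℤ)
    {x y : Fin d → I} (hx : x ∈ gridCell δ n) (hy : y ∈ gridCell δ n) :
    |f x - f y| ≤ δ * (column δ f n).ncard := by
  have main : ∀ x ∈ gridCell δ n, ∀ y ∈ gridCell δ n, f x ≤ f y →
      f y - f x ≤ δ * (column δ f n).ncard := by
    intro x hx y hy hxy
    have hsub : Set.Icc ⌊f x / δ⌋ ⌊f y / δ⌋ ⊆ column δ f n := by
      rintro j ⟨hj1, hj2⟩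
      have hj3 : (j : ℝ) * δ ≤ f y := by
        have := Int.le_floor.1 hj2
        rwa [le_div_iff₀ hδ] at this
      have hj4 : f x ≤ ((j : ℝ) + 1) * δ := by
        have h1 : f x / δ < ⌊f x / δ⌋ + 1 := Int.lt_floor_add_one _
        have h2 : ((⌊f x / δ⌋ : ℤ) : ℝ) ≤ j := by exact_mod_cast hj1
        have h3 : f x / δ ≤ j + 1 := by linarith
        rwa [div_le_iff₀ hδ] at h3
      obtain ⟨z, hz, hzv⟩ := (isPreconnected_gridCell δ n).intermediate_value hx hy
        f.continuous.continuousOn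
        (show max (f x) (j * δ) ∈ Set.Icc (f x) (f y) from ⟨le_max_left _ _, max_le hxy hj3⟩)
      refine ⟨z, hz, ?_, ?_⟩
      · rw [hzv]; exact le_max_right _ _
      · rw [hzv]; exact max_le hj4 (by nlinarith)
    have hcard := Set.ncard_le_ncard hsub (finite_column hδ f n)
    have hIcc : (Set.Icc ⌊f x / δ⌋ ⌊f y / δ⌋).ncard = (⌊f y / δ⌋ + 1 - ⌊f x / δ⌋).toNat := by
      rw [← Finset.coe_Icc, Set.ncard_coe_finset, Int.card_Icc]
    rw [hIcc] at hcard
    have h5 : ⌊f y / δ⌋ + 1 - ⌊f x / δ⌋ ≤ ((column δ f n).ncard : ℤ) := by omega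
    have h6 : ((⌊f y / δ⌋ : ℤ) : ℝ) + 1 - ⌊f x / δ⌋ ≤ (column δ f n).ncard := by
      exact_mod_cast h5
    have h7 : f y / δ < ⌊f y / δ⌋ + 1 := Int.lt_floor_add_one _
    have h8 : (⌊f x / δ⌋ : ℝ) ≤ f x / δ := Int.floor_le _
    have h9 : (f y - f x) / δ ≤ (column δ f n).ncard := by
      rw [sub_div]; linarith
    rw [div_le_iff₀ hδ] at h9
    linarith
  rcases le_total (f x) (f y) with h | h
  · rw [abs_sub_comm, abs_of_nonneg (by linarith)]; exact main x hx y hy h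
  · rw [abs_of_nonneg (by linarith)]; exact main y hy x hx h

theorem column_le_osc {d : ℕ} {δ R : ℝ} (hδ : 0 < δ) (h : C(Fin d → I, ℝ)) (n : Fin d → ℤ)
    (hR : 0 ≤ R)
    (hosc : ∀ x ∈ gridCell δ n, ∀ y ∈ gridCell δ n, |h x - h y| ≤ δ * R) :
    ((column δ h n).ncard : ℝ) ≤ 2 * R + 2 := by
  rcases (gridCell δ n).eq_empty_or_nonempty with he | ⟨x₀, hx₀⟩
  · have : column δ h n = ∅ := by
      ext j; simp [column, he]
    rw [this]; simp; linarith
  · have hsub : column δ h n ⊆ Set.Icc ⌈h x₀ / δ - R - 1⌉ ⌊h x₀ / δ + R⌋ := by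
      rintro j ⟨x, hx, h1, h2⟩
      have h3 := abs_le.1 (hosc x hx x₀ hx₀)
      constructor
      · rw [Int.ceil_le]
        have : h x₀ / δ ≤ j + 1 + R := by rw [div_le_iff₀ hδ]; nlinarith
        linarith
      · rw [Int.le_floor]
        have : (j : ℝ) - R ≤ h x₀ / δ := by rw [le_div_iff₀ hδ]; nlinarith
        linarith
    have hcard := Set.ncard_le_ncard hsub (Set.finite_Icc _ _)
    rw [← Finset.coe_Icc, Set.ncard_coe_finset, Int.card_Icc] at hcard
    have h4 : ((⌊h x₀ / δ + R⌋ : ℤ) : ℝ) ≤ h x₀ / δ + R := Int.floor_le _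
    have h5 : h x₀ / δ - R - 1 ≤ ((⌈h x₀ / δ - R - 1⌉ : ℤ) : ℝ) := Int.le_ceil _
    have h6 : (((⌊h x₀ / δ + R⌋ + 1 - ⌈h x₀ / δ - R - 1⌉).toNat : ℤ) : ℝ) ≤ 2 * R + 2 := by
      rw [Int.toNat_eq_max]
      push_cast
      exact max_le (by linarith) (by linarith)
    calc ((column δ h n).ncard : ℝ) ≤
        (((⌊h x₀ / δ + R⌋ + 1 - ⌈h x₀ / δ - R - 1⌉).toNat : ℤ) : ℝ) := by exact_mod_cast hcard
      _ ≤ _ := h6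

theorem finite_cells {d : ℕ} {δ : ℝ} (hδ : 0 < δ) :
    {n : Fin d → ℤ | (gridCell δ n).Nonempty}.Finite := by
  refine ((finite_hitCubes hδ (0 : C(Fin d → I, ℝ))).image Fin.init).subset ?_
  rintro n ⟨x, hx⟩
  refine ⟨Fin.snoc (α := fun _ => ℤ) n 0, ?_, by simp⟩
  rw [mem_hitCubes_iff_column]
  simp only [Fin.snoc_last, Fin.init_snoc]
  exact ⟨x, hx, by simp, by simp [hδ.le]⟩

theorem boxCount_eq_sum {d : ℕ} {δ : ℝ} (hδ : 0 < δ) (f : C(Fin d → I, ℝ)) :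
    boxCount δ (graph f) = ∑ n ∈ (finite_cells (d := d) hδ).toFinset, (column δ f n).ncard := by
  classical
  have hfin := finite_hitCubes hδ f
  rw [boxCount, Set.ncard_eq_toFinset_card _ hfin,
    Finset.card_eq_sum_card_fiberwise (f := fun m => Fin.init m)
      (t := (finite_cells (d := d) hδ).toFinset)]
  · refine Finset.sum_congr rfl fun n _ => ?_
    rw [← Set.ncard_coe_finset]
    refine Set.ncard_congr (fun m _ => m (Fin.last d)) ?_ ?_ ?_
    · intro m hm
      simp only [Finset.coe_filter, Set.Finite.mem_toFinset, Set.mem_ofPred_eq] at hm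
      have := mem_hitCubes_iff_column.1 hm.1
      rwa [hm.2] at this
    · intro a b ha hb hab
      simp only [Finset.coe_filter, Set.Finite.mem_toFinset, Set.mem_ofPred_eq] at ha hb
      rw [← Fin.snoc_init_self a, ← Fin.snoc_init_self b, ha.2, hb.2, hab]
    · intro j hj
      refine ⟨Fin.snoc (α := fun _ => ℤ) n j, ?_, by simp⟩
      simp only [Finset.coe_filter, Set.Finite.mem_toFinset, Set.mem_ofPred_eq]
      exact ⟨mem_hitCubes_iff_column.2 (by simpa using hj), by simp⟩
  · intro m hm
    have hm' : m ∈ hitCubes δ (graph f) := by simpa using hm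
    obtain ⟨x, hx, _⟩ := mem_hitCubes_iff_column.1 hm'
    simp only [Set.Finite.coe_toFinset, Set.mem_ofPred_eq]
    exact ⟨x, hx⟩

theorem one_le_column {d : ℕ} {δ : ℝ} (hδ : 0 < δ) (f : C(Fin d → I, ℝ)) {n : Fin d → ℤ}
    (hn : (gridCell δ n).Nonempty) : 1 ≤ (column δ f n).ncard := by
  obtain ⟨x, hx⟩ := hn
  refine (Set.ncard_pos (finite_column hδ f n)).2 ⟨⌊f x / δ⌋, x, hx, ?_, ?_⟩
  · exact (le_div_iff₀ hδ).1 (Int.floor_le _)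
  · exact (div_le_iff₀ hδ).1 (Int.lt_floor_add_one _).le

theorem one_le_boxCount {d : ℕ} {δ : ℝ} (hδ : 0 < δ) (f : C(Fin d → I, ℝ)) :
    1 ≤ boxCount δ (graph f) := by
  have hfin := finite_hitCubes hδ f
  refine (Set.ncard_pos hfin).2 ⟨Fin.snoc (α := fun _ => ℤ) (fun _ => 0) ⌊f 0 / δ⌋, ?_⟩
  rw [mem_hitCubes_graph]
  refine ⟨0, fun i => by simp [hδ.le], ?_⟩
  simp only [Fin.snoc_last]
  exact ⟨(le_div_iff₀ hδ).1 (Int.floor_le _), (div_le_iff₀ hδ).1 (Int.lt_floor_add_one _).le⟩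

theorem boxCount_le {d : ℕ} {δ a b : ℝ} (hδ : 0 < δ) (ha : 0 ≤ a) (hb : 0 ≤ b)
    (f g h : C(Fin d → I, ℝ))
    (hfg : ∀ x y, |h x - h y| ≤ a * |f x - f y| + b * |g x - g y|) :
    (boxCount δ (graph h) : ℝ) ≤
      (2 * a + 2) * boxCount δ (graph f) + 2 * b * boxCount δ (graph g) := by
  rw [boxCount_eq_sum hδ, boxCount_eq_sum hδ, boxCount_eq_sum hδ]
  push_cast
  rw [Finset.mul_sum, Finset.mul_sum, ← Finset.sum_add_distrib]
  refine Finset.sum_le_sum fun n hn => ?_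
  have hn' : (gridCell δ n).Nonempty := by simpa using hn
  have h1 : (1 : ℝ) ≤ (column δ f n).ncard := by exact_mod_cast one_le_column hδ f hn'
  have := column_le_osc hδ h n
    (R := a * (column δ f n).ncard + b * (column δ g n).ncard) (by positivity) (by
      intro x hx y hy
      have h2 := mul_le_mul_of_nonneg_left (osc_le_column hδ f n hx hy) ha
      have h3 := mul_le_mul_of_nonneg_left (osc_le_column hδ g n hx hy) hb
      have := hfg x y
      nlinarith)
  linarith

/-- If `N_δ(F) ≤ C δ^{-b}` eventually for every `b > α` (with `C` depending on `b`), then the upper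
box dimension of `F` is at most `α`. -/
theorem upperBoxDim_le_of {n : ℕ} {F : Set (Fin n → ℝ)} {α : ℝ}
    (h : ∀ b : ℝ, α < b → ∃ c : ℝ, ∀ᶠ δ in 𝓝[>] (0 : ℝ),
      Real.log (boxCount δ F) ≤ c + b * -Real.log δ) :
    upperBoxDim F ≤ α := by
  refine le_of_forall_gt_imp_ge_of_dense fun e he => ?_
  obtain ⟨q, hq1, hq2⟩ := EReal.lt_iff_exists_real_btwn.1 he
  have hq1' : α < q := EReal.coe_lt_coe_iff.1 hq1
  obtain ⟨b, hb1, hb2⟩ := exists_between hq1'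
  obtain ⟨c, hc⟩ := h b hb1
  refine le_trans ?_ hq2.le
  refine limsup_le_of_le (by isBoundedDefault) ?_
  have hlog : Tendsto (fun δ : ℝ => -Real.log δ) (𝓝[>] 0) atTop :=
    tendsto_neg_atBot_atTop.comp Real.tendsto_log_nhdsGT_zero
  filter_upwards [hc, hlog.eventually_gt_atTop 0, hlog.eventually_ge_atTop (c / (q - b))]
    with δ h1 h2 h3
  rw [EReal.coe_le_coe_iff, div_le_iff₀ h2]
  rw [div_le_iff₀ (by linarith)] at h3
  nlinarith

theorem eventually_of_upperBoxDim_le {n : ℕ} {F : Set (Fin n → ℝ)} {α b : ℝ}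
    (h : upperBoxDim F ≤ α) (hb : α < b) :
    ∀ᶠ δ in 𝓝[>] (0 : ℝ), Real.log (boxCount δ F) ≤ b * -Real.log δ := by
  have h1 : upperBoxDim F < (b : EReal) := h.trans_lt (EReal.coe_lt_coe_iff.2 hb)
  have hlog : Tendsto (fun δ : ℝ => -Real.log δ) (𝓝[>] 0) atTop :=
    tendsto_neg_atBot_atTop.comp Real.tendsto_log_nhdsGT_zero
  filter_upwards [eventually_lt_of_limsup_lt h1, hlog.eventually_gt_atTop 0] with δ h2 h3
  rw [EReal.coe_lt_coe_iff, div_lt_iff₀ h3] at h2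
  exact h2.le

theorem upperBoxDim_graph_le_of_osc_le {d : ℕ} {a b α : ℝ} (ha : 0 ≤ a) (hb : 0 ≤ b)
    (f g h : C(Fin d → I, ℝ))
    (hfg : ∀ x y, |h x - h y| ≤ a * |f x - f y| + b * |g x - g y|)
    (hf : upperBoxDim (graph f) ≤ α) (hg : upperBoxDim (graph g) ≤ α) :
    upperBoxDim (graph h) ≤ α := by
  refine upperBoxDim_le_of fun e he => ⟨Real.log (2 * a + 2 + 2 * b), ?_⟩
  filter_upwards [eventually_of_upperBoxDim_le hf he, eventually_of_upperBoxDim_le hg he,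
    self_mem_nhdsWithin] with δ h1 h2 hδ
  have hδ : 0 < δ := hδ
  have pf : (0 : ℝ) < boxCount δ (graph f) := by exact_mod_cast one_le_boxCount hδ f
  have pg : (0 : ℝ) < boxCount δ (graph g) := by exact_mod_cast one_le_boxCount hδ g
  have ph : (0 : ℝ) < boxCount δ (graph h) := by exact_mod_cast one_le_boxCount hδ h
  rw [Real.log_le_iff_le_exp pf] at h1
  rw [Real.log_le_iff_le_exp pg] at h2
  rw [Real.log_le_iff_le_exp ph, Real.exp_add, Real.exp_log (by positivity)]
  have h3 := boxCount_le hδ ha hb f g h hfg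
  have h4 := mul_le_mul_of_nonneg_left h1 (show 0 ≤ 2 * a + 2 by positivity)
  have h5 := mul_le_mul_of_nonneg_left h2 (show 0 ≤ 2 * b by positivity)
  linarith

theorem upperBoxDim_graph_zero_le {d : ℕ} {α : ℝ} (hα : (d : ℝ) ≤ α) :
    upperBoxDim (graph (0 : C(Fin d → I, ℝ))) ≤ α := by
  refine upperBoxDim_le_of fun e he => ⟨Real.log (2 * 3 ^ d), ?_⟩
  filter_upwards [Ioo_mem_nhdsGT (zero_lt_one' ℝ)] with δ hδ
  obtain ⟨hδ, hδ1⟩ := hδ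
  have hcol : ∀ n : Fin d → ℤ, ((column δ (0 : C(Fin d → I, ℝ)) n).ncard : ℝ) ≤ 2 := fun n => by
    simpa using column_le_osc (R := 0) hδ (0 : C(Fin d → I, ℝ)) n le_rfl (by simp)
  have hcells : ((finite_cells (d := d) hδ).toFinset.card : ℝ) ≤ (3 / δ) ^ d := by
    have hsub : (finite_cells (d := d) hδ).toFinset ⊆
        Finset.Icc (fun _ : Fin d => (-1 : ℤ)) (fun _ => ⌊1 / δ⌋) := by
      intro n hn
      obtain ⟨x, hx⟩ : (gridCell δ n).Nonempty := by simpa using hn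
      rw [Finset.mem_Icc]
      refine ⟨fun i => ?_, fun i => ?_⟩
      · have h1 := (x i).2.1.trans (hx i).2
        have h2 : (0 : ℝ) ≤ (n i : ℝ) + 1 := nonneg_of_mul_nonneg_left h1 hδ
        have h3 : (0 : ℤ) ≤ n i + 1 := by exact_mod_cast h2
        show (-1 : ℤ) ≤ n i
        omega
      · show n i ≤ ⌊1 / δ⌋
        rw [Int.le_floor, le_div_iff₀ hδ]
        exact (hx i).1.trans (x i).2.2
    have hle := Finset.card_le_card hsub
    rw [Pi.card_Icc] at hle
    simp only [Int.card_Icc, Finset.prod_const, Finset.card_univ, Fintype.card_fin] at hle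
    have hfl : ((⌊1 / δ⌋ : ℤ) : ℝ) ≤ 1 / δ := Int.floor_le _
    have hfl0 : 0 ≤ ⌊1 / δ⌋ := Int.floor_nonneg.2 (by positivity)
    have h1δ : 1 ≤ 1 / δ := by rw [le_div_iff₀ hδ]; linarith
    have hb : (((⌊1 / δ⌋ + 1 - -1).toNat : ℕ) : ℝ) ≤ 3 / δ := by
      have h1 : (((⌊1 / δ⌋ + 1 - -1).toNat : ℕ) : ℤ) = ⌊1 / δ⌋ + 2 := by omega
      have h2 : (((⌊1 / δ⌋ + 1 - -1).toNat : ℕ) : ℝ) = (⌊1 / δ⌋ : ℝ) + 2 := by exact_mod_cast h1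
      rw [h2, show 3 / δ = 3 * (1 / δ) by ring]
      linarith
    calc ((finite_cells (d := d) hδ).toFinset.card : ℝ)
        ≤ (((⌊1 / δ⌋ + 1 - -1).toNat : ℕ) : ℝ) ^ d := by exact_mod_cast hle
      _ ≤ _ := pow_le_pow_left₀ (Nat.cast_nonneg _) hb d
  have hN : (boxCount δ (graph (0 : C(Fin d → I, ℝ))) : ℝ) ≤ 2 * 3 ^ d * (1 / δ) ^ d := by
    rw [boxCount_eq_sum hδ]
    push_cast
    calc _ ≤ ∑ n ∈ (finite_cells (d := d) hδ).toFinset, (2 : ℝ) :=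
          Finset.sum_le_sum fun n _ => hcol n
      _ = (finite_cells (d := d) hδ).toFinset.card * 2 := by simp
      _ ≤ (3 / δ) ^ d * 2 := by gcongr
      _ = _ := by rw [div_pow, div_pow]; ring
  have p0 : (0 : ℝ) < boxCount δ (graph (0 : C(Fin d → I, ℝ))) := by
    exact_mod_cast one_le_boxCount hδ 0
  have hlogδ : 0 < -Real.log δ := by
    have := Real.log_neg hδ hδ1
    linarith
  calc Real.log (boxCount δ (graph (0 : C(Fin d → I, ℝ))))
      ≤ Real.log (2 * 3 ^ d * (1 / δ) ^ d) := Real.log_le_log p0 hN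
    _ = Real.log (2 * 3 ^ d) + d * -Real.log δ := by
        rw [Real.log_mul (by positivity) (by positivity), Real.log_pow, one_div, Real.log_inv]
    _ ≤ _ := by nlinarith

/-- The vector space `C_α[0,1]^d` of continuous functions whose graph has upper box dimension at
most `α`, where `α ≥ d`. -/
def boxSubmodule (d : ℕ) (α : ℝ) (hα : (d : ℝ) ≤ α) : Submodule ℝ C(Fin d → I, ℝ) where
  carrier := {f | upperBoxDim (graph f) ≤ α}
  add_mem' {f g} hf hg := by
    refine upperBoxDim_graph_le_of_osc_le zero_le_one zero_le_one f g (f + g) (fun x y => ?_) hf hg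
    simp only [ContinuousMap.add_apply, one_mul]
    rw [add_sub_add_comm]
    exact abs_add_le _ _
  zero_mem' := upperBoxDim_graph_zero_le hα
  smul_mem' c f hf := by
    refine upperBoxDim_graph_le_of_osc_le (abs_nonneg c) le_rfl f f (c • f) (fun x y => ?_) hf hf
    simp [← mul_sub, abs_mul]

/-- `C_α[0,1]^d` as a type of its own, so that it does not inherit the topology of uniform
convergence. -/
def BoxSpace (d : ℕ) (α : ℝ) (hα : (d : ℝ) ≤ α) : Type := boxSubmodule d α hα

instance (d : ℕ) (α : ℝ) (hα : (d : ℝ) ≤ α) : AddCommGroup (BoxSpace d α hα) :=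
  inferInstanceAs (AddCommGroup (boxSubmodule d α hα))

instance (d : ℕ) (α : ℝ) (hα : (d : ℝ) ≤ α) : Module ℝ (BoxSpace d α hα) :=
  inferInstanceAs (Module ℝ (boxSubmodule d α hα))

/-- The underlying continuous function of an element of `C_α[0,1]^d`. -/
def BoxSpace.toFun {d : ℕ} {α : ℝ} {hα : (d : ℝ) ≤ α} (f : BoxSpace d α hα) :
    C(Fin d → I, ℝ) := Subtype.val f

/-! ### The metric of `C_α[0,1]^d` -/

/-- The range `R_f(S) = sup_{x, y ∈ S} |f x - f y|`, in `[0, ∞]`. -/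
def rangeOn {d : ℕ} (f : C(Fin d → I, ℝ)) (S : Set (Fin d → I)) : ℝ≥0∞ :=
  ⨆ x ∈ S, ⨆ y ∈ S, ‖f x - f y‖ₑ

/-- The sum of `R_f(S)` over the cubes `S` of the `δ`-mesh on `[0,1]^d`, that is, those with
indices in `{0, …, ⌈δ⁻¹⌉ - 1}^d`. -/
def rangeSum {d : ℕ} (δ : ℝ) (f : C(Fin d → I, ℝ)) : ℝ≥0∞ :=
  ∑ n : Fin d → Fin ⌈δ⁻¹⌉₊, rangeOn f (gridCell δ fun i => ((n i : ℕ) : ℤ))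

/-- The (extended) norm `‖f‖_{β,d}`. -/
def boxNorm {d : ℕ} (β : ℝ) (f : C(Fin d → I, ℝ)) : ℝ≥0∞ :=
  ‖f‖ₑ + ⨆ δ ∈ Set.Ioc (0 : ℝ) 1, rangeSum δ f / ENNReal.ofReal (δ ^ (1 - β))

/-- The metric `d_{α,d}(f, g) = ∑_{k ≥ 1} min {2^{-k}, ‖f - g‖_{α + 1/k, d}}`. -/
def boxEDist {d : ℕ} (α : ℝ) (f g : C(Fin d → I, ℝ)) : ℝ≥0∞ :=
  ∑' k : ℕ, min ((2 : ℝ≥0∞)⁻¹ ^ (k + 1)) (boxNorm (α + 1 / ((k : ℝ) + 1)) (f - g))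

theorem rangeOn_add_le {d : ℕ} (f g : C(Fin d → I, ℝ)) (S : Set (Fin d → I)) :
    rangeOn (f + g) S ≤ rangeOn f S + rangeOn g S := by
  refine iSup₂_le fun x hx => iSup₂_le fun y hy => ?_
  have h1 : ‖f x - f y‖ₑ ≤ rangeOn f S :=
    le_iSup₂_of_le x hx (le_iSup₂_of_le y hy le_rfl)
  have h2 : ‖g x - g y‖ₑ ≤ rangeOn g S :=
    le_iSup₂_of_le x hx (le_iSup₂_of_le y hy le_rfl)
  simp only [ContinuousMap.add_apply]
  rw [add_sub_add_comm]
  exact (enorm_add_le _ _).trans (add_le_add h1 h2)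

theorem boxNorm_add_le {d : ℕ} (β : ℝ) (f g : C(Fin d → I, ℝ)) :
    boxNorm β (f + g) ≤ boxNorm β f + boxNorm β g := by
  unfold boxNorm
  rw [add_add_add_comm]
  refine add_le_add (enorm_add_le f g) (iSup₂_le fun δ hδ => ?_)
  refine le_trans ?_ (add_le_add
    (le_iSup₂ (f := fun δ (_ : δ ∈ Set.Ioc (0 : ℝ) 1) =>
      rangeSum δ f / ENNReal.ofReal (δ ^ (1 - β))) δ hδ)
    (le_iSup₂ (f := fun δ (_ : δ ∈ Set.Ioc (0 : ℝ) 1) =>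
      rangeSum δ g / ENNReal.ofReal (δ ^ (1 - β))) δ hδ))
  rw [← ENNReal.add_div]
  gcongr
  unfold rangeSum
  rw [← Finset.sum_add_distrib]
  exact Finset.sum_le_sum fun n _ => rangeOn_add_le f g _

theorem rangeOn_neg {d : ℕ} (f : C(Fin d → I, ℝ)) (S : Set (Fin d → I)) :
    rangeOn (-f) S = rangeOn f S := by
  have h : ∀ x y, ‖(-f) x - (-f) y‖ₑ = ‖f x - f y‖ₑ := fun x y => by
    rw [← enorm_neg, ContinuousMap.neg_apply, ContinuousMap.neg_apply]
    congr 1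
    ring
  simp only [rangeOn, h]

theorem boxNorm_neg {d : ℕ} (β : ℝ) (f : C(Fin d → I, ℝ)) : boxNorm β (-f) = boxNorm β f := by
  simp only [boxNorm, rangeSum, rangeOn_neg, enorm_neg]

theorem boxNorm_zero {d : ℕ} (β : ℝ) : boxNorm β (0 : C(Fin d → I, ℝ)) = 0 := by
  simp [boxNorm, rangeSum, rangeOn, enorm_eq_nnnorm]

theorem boxEDist_ne_top {d : ℕ} (α : ℝ) (f g : C(Fin d → I, ℝ)) : boxEDist α f g ≠ ⊤ := by
  refine ne_top_of_le_ne_top ENNReal.one_ne_top ?_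
  calc boxEDist α f g ≤ ∑' k : ℕ, (2 : ℝ≥0∞)⁻¹ ^ (k + 1) :=
        ENNReal.tsum_le_tsum fun k => min_le_left _ _
    _ = 1 := by
        rw [ENNReal.tsum_geometric_add_one, ENNReal.one_sub_inv_two, inv_inv]
        exact ENNReal.inv_mul_cancel (by simp) (by simp)

/-- `d_{α,d}` as an extended metric; it is the distance of the metric space below. -/
abbrev boxEMetricSpace (d : ℕ) (α : ℝ) (hα : (d : ℝ) ≤ α) : EMetricSpace (BoxSpace d α hα) where
  edist f g := boxEDist α f.toFun g.toFun
  edist_self f := by simp [boxEDist, boxNorm_zero]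
  edist_comm f g := by
    unfold boxEDist
    refine tsum_congr fun k => ?_
    rw [← boxNorm_neg, neg_sub]
  edist_triangle f g h := by
    unfold boxEDist
    rw [← ENNReal.tsum_add]
    refine ENNReal.tsum_le_tsum fun k => ?_
    have h1 := boxNorm_add_le (α + 1 / ((k : ℝ) + 1)) (f.toFun - g.toFun) (g.toFun - h.toFun)
    rw [sub_add_sub_cancel] at h1
    refine (min_le_min_left _ h1).trans ?_
    rcases le_total ((2 : ℝ≥0∞)⁻¹ ^ (k + 1)) (boxNorm (α + 1 / ((k : ℝ) + 1))
      (f.toFun - g.toFun)) with h2 | h2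
    · rw [min_eq_left h2]; exact (min_le_left _ _).trans le_self_add
    · rw [min_eq_right h2]
      rcases le_total ((2 : ℝ≥0∞)⁻¹ ^ (k + 1)) (boxNorm (α + 1 / ((k : ℝ) + 1))
        (g.toFun - h.toFun)) with h3 | h3
      · rw [min_eq_left h3]; exact (min_le_left _ _).trans le_add_self
      · rw [min_eq_right h3]; exact min_le_right _ _
  eq_of_edist_eq_zero {f g} h := by
    have h1 := ENNReal.tsum_eq_zero.1 h 0
    have h2 : boxNorm (α + 1 / (((0 : ℕ) : ℝ) + 1)) (f.toFun - g.toFun) = 0 := by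
      rcases min_choice ((2 : ℝ≥0∞)⁻¹ ^ (0 + 1))
        (boxNorm (α + 1 / (((0 : ℕ) : ℝ) + 1)) (f.toFun - g.toFun)) with h3 | h3
      · rw [h3] at h1; simp at h1
      · rwa [h3] at h1
    have h4 : ‖f.toFun - g.toFun‖ₑ = 0 := by
      unfold boxNorm at h2
      exact (add_eq_zero.1 h2).1
    have h5 : f.toFun - g.toFun = 0 := by simpa [enorm_eq_nnnorm] using h4
    exact Subtype.ext (sub_eq_zero.1 h5)

instance (d : ℕ) (α : ℝ) (hα : (d : ℝ) ≤ α) : MetricSpace (BoxSpace d α hα) :=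
  letI := boxEMetricSpace d α hα
  EMetricSpace.toMetricSpace fun f g => boxEDist_ne_top α f.toFun g.toFun

instance (d : ℕ) (α : ℝ) (hα : (d : ℝ) ≤ α) : MeasurableSpace (BoxSpace d α hα) := borel _

instance (d : ℕ) (α : ℝ) (hα : (d : ℝ) ≤ α) : BorelSpace (BoxSpace d α hα) := ⟨rfl⟩

/-! ### Prevalence -/

/-- `F` is prevalent in the (completely metrizable topological) vector space `X`: it is Borel, and
there are a Borel measure `μ` and a compact set `K` with `0 < μ K < ∞` such that every translate of
`F` has a `μ`-null complement. -/
def IsPrevalent {X : Type*} [AddCommGroup X] [TopologicalSpace X] [MeasurableSpace X]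
    [BorelSpace X] (F : Set X) : Prop :=
  MeasurableSet F ∧ ∃ (μ : Measure X) (K : Set X), IsCompact K ∧ 0 < μ K ∧ μ K < ⊤ ∧
    ∀ x : X, μ ((fun y => y + x) '' F)ᶜ = 0

/-! ### The two sets of surfaces -/

/-- `C_α[0,1]²` for `α ≥ 2`. -/
abbrev SurfaceSpace (α : ℝ) (hα : 2 ≤ α) : Type := BoxSpace 2 α (by exact_mod_cast hα)

/-- `U_α[0,1]²`. -/
def setU (α : ℝ) (hα : 2 ≤ α) : Set (SurfaceSpace α hα) :=
  {f | (lowerBoxDim (graph f.toFun) = α ∧ upperBoxDim (graph f.toFun) = α) ∧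
    ((α - 1 : ℝ) : EReal) ≤ lowerBoxDim (graph (horizon f.toFun)) ∧
    lowerBoxDim (graph (horizon f.toFun)) ≤ upperBoxDim (graph (horizon f.toFun)) ∧
    upperBoxDim (graph (horizon f.toFun)) < 2}

/-- `L_α[0,1]²`. -/
def setL (α : ℝ) (hα : 2 ≤ α) : Set (SurfaceSpace α hα) :=
  {f | (lowerBoxDim (graph f.toFun) = α ∧ upperBoxDim (graph f.toFun) = α) ∧
    ((α - 1 : ℝ) : EReal) < lowerBoxDim (graph (horizon f.toFun)) ∧
    lowerBoxDim (graph (horizon f.toFun)) ≤ upperBoxDim (graph (horizon f.toFun)) ∧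
    upperBoxDim (graph (horizon f.toFun)) ≤ 2}

end Horizon

end

noncomputable section

namespace Horizon

/-! ### Functions whose oscillation is controlled row by row -/

/-! Suppose a measure `μ` and a compact set `K` witness prevalence. The members of `K` share a
modulus of continuity `ω` in the vertical variable (`exists_uniform_modulus`). Adding the penalty
`-ω |y - y₀|` to any `f ∈ K` pushes every vertical maximum onto the row `y = y₀`, where the penalty
vanishes, so the horizon becomes the restriction of `f` to that row. A translation thus turns a
statement about horizons into one about a row of one's choice, simultaneously for all `f ∈ K`.

For `setU`, use two translates: the penalty at row `0`, and the same penalty plus `takagiSurface`,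
which is itself maximal on row `0`. Some `f ∈ K` has both translates in `setU`, so the two horizons
both have upper dimension below `2`. Their difference is the trace of `takagiSurface` on row `0`,
and it would then also have upper dimension below `2`; but `two_le_upperBoxDim_slice_takagiSurface`
excludes this. The weights `1 / (k + 1)²` are summable, yet decay too slowly to lower the dimension
of the trace. The factor `ramp (2 ^ k * y)` confines the teeth of width `2⁻ᵏ` to a strip of height
`2⁻ᵏ`, so that the surface itself still has dimension at most `2`.

For `setL`, let `y₀` vary. By `ae_lowerBoxDim_slice_le`, almost every row of a surface of upper
dimension at most `α` has lower dimension at most `α - 1`. So for fixed `f ∈ K` the penalised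
function lies outside `setL` for almost every `y₀`, whereas for fixed `y₀` prevalence puts it inside
for almost every `f`. Fubini's theorem on `K × [0,1]` makes these incompatible.

The penalties and `takagiSurface` must belong to `C_α`, and the penalty must depend continuously on
`y₀` in its metric. Since `ω` need not be Lipschitz or even Hölder, both facts rest on
`HasRowBound`: oscillations summed along the vertical direction stay bounded at every scale, as for
functions of bounded variation. -/

/-- At each scale `δ ∈ (0,1]`, the oscillation of `h` on the mesh squares is bounded by a function
of the row whose sum over the rows is at most `C`. -/
def HasRowBound (h : C(Fin 2 → I, ℝ)) (C : ℝ) : Prop :=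
  ∀ δ : ℝ, 0 < δ → δ ≤ 1 → ∃ B : ℤ → ℝ, (∀ j, 0 ≤ B j) ∧
    (∀ n : Fin 2 → ℤ, ∀ p ∈ gridCell δ n, ∀ q ∈ gridCell δ n, |h p - h q| ≤ B (n 1)) ∧
    ∑ j ∈ Finset.Icc (-1) ⌊1 / δ⌋, B j ≤ C

theorem HasRowBound.nonneg {h : C(Fin 2 → I, ℝ)} {C : ℝ} (hC : HasRowBound h C) : 0 ≤ C := by
  obtain ⟨B, hB, -, hs⟩ := hC 1 one_pos le_rfl
  exact (Finset.sum_nonneg fun j _ => hB j).trans hs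

theorem HasRowBound.add {g h : C(Fin 2 → I, ℝ)} {C D : ℝ} (hg : HasRowBound g C)
    (hh : HasRowBound h D) : HasRowBound (g + h) (C + D) := by
  intro δ hδ hδ1
  obtain ⟨B, hB, hgB, hBs⟩ := hg δ hδ hδ1
  obtain ⟨B', hB', hhB, hBs'⟩ := hh δ hδ hδ1
  refine ⟨fun j => B j + B' j, fun j => add_nonneg (hB j) (hB' j), fun n p hp q hq => ?_, ?_⟩
  · have h1 := hgB n p hp q hq
    have h2 := hhB n p hp q hq
    simp only [ContinuousMap.add_apply]
    rw [add_sub_add_comm]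
    exact (abs_add_le _ _).trans (add_le_add h1 h2)
  · rw [Finset.sum_add_distrib]
    exact add_le_add hBs hBs'

theorem HasRowBound.neg {g : C(Fin 2 → I, ℝ)} {C : ℝ} (hg : HasRowBound g C) :
    HasRowBound (-g) C := by
  intro δ hδ hδ1
  obtain ⟨B, hB, hgB, hBs⟩ := hg δ hδ hδ1
  refine ⟨B, hB, fun n p hp q hq => ?_, hBs⟩
  have h1 := hgB n q hq p hp
  simp only [ContinuousMap.neg_apply]
  rwa [neg_sub_neg]

theorem index_bounds {δ : ℝ} (hδ : 0 < δ) {k : ℤ} {t : I} (h1 : (k : ℝ) * δ ≤ t)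
    (h2 : (t : ℝ) ≤ ((k : ℝ) + 1) * δ) : k ∈ Finset.Icc (-1) ⌊1 / δ⌋ := by
  rw [Finset.mem_Icc, Int.le_floor, le_div_iff₀ hδ]
  refine ⟨?_, h1.trans t.2.2⟩
  have h3 : (0 : ℝ) ≤ (k : ℝ) + 1 := nonneg_of_mul_nonneg_left (t.2.1.trans h2) hδ
  have h4 : (0 : ℤ) ≤ k + 1 := by exact_mod_cast h3
  omega

theorem card_index_le {δ : ℝ} (hδ : 0 < δ) (hδ1 : δ ≤ 1) :
    ((Finset.Icc (-1) ⌊1 / δ⌋).card : ℝ) ≤ 3 / δ := by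
  have h1δ : 1 ≤ 1 / δ := by rw [le_div_iff₀ hδ]; linarith
  have hfl : ((⌊1 / δ⌋ : ℤ) : ℝ) ≤ 1 / δ := Int.floor_le _
  have hfl0 : 0 ≤ ⌊1 / δ⌋ := Int.floor_nonneg.2 (by positivity)
  have h1 : ((Finset.Icc (-1) ⌊1 / δ⌋).card : ℤ) = ⌊1 / δ⌋ + 2 := by
    rw [Int.card_Icc]; omega
  have h2 : ((Finset.Icc (-1) ⌊1 / δ⌋).card : ℝ) = (⌊1 / δ⌋ : ℝ) + 2 := by exact_mod_cast h1
  rw [h2, show 3 / δ = 3 * (1 / δ) by ring]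
  linarith

/-- There are at most `3 / δ` cells in a row, all with the same oscillation bound, so the
oscillations over the whole mesh sum to at most `3 * C / δ`. Dividing by `δ` gives order `δ⁻²`
boxes, the same order as the number of cells. -/
theorem HasRowBound.boxCount_le {h : C(Fin 2 → I, ℝ)} {C δ : ℝ} (hC : HasRowBound h C)
    (hδ : 0 < δ) (hδ1 : δ ≤ 1) : (boxCount δ (graph h) : ℝ) ≤ (6 * C + 18) * (1 / δ) ^ 2 := by
  obtain ⟨B, hB, hhB, hBs⟩ := hC δ hδ hδ1
  have hcard := card_index_le hδ hδ1
  set J := Finset.Icc (-1) ⌊1 / δ⌋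
  have hsub : (finite_cells (d := 2) hδ).toFinset ⊆
      (J ×ˢ J).map (finTwoArrowEquiv ℤ).symm.toEmbedding := by
    intro n hn
    obtain ⟨x, hx⟩ : (gridCell δ n).Nonempty := by simpa using hn
    rw [Finset.mem_map_equiv, Finset.mem_product]
    exact ⟨index_bounds hδ (hx 0).1 (hx 0).2, index_bounds hδ (hx 1).1 (hx 1).2⟩
  rw [boxCount_eq_sum hδ]
  push_cast
  calc ∑ n ∈ (finite_cells (d := 2) hδ).toFinset, ((column δ h n).ncard : ℝ)
      ≤ ∑ n ∈ (finite_cells (d := 2) hδ).toFinset, (2 * (B (n 1) / δ) + 2) := by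
        refine Finset.sum_le_sum fun n _ => column_le_osc hδ h n (div_nonneg (hB _) hδ.le) ?_
        intro x hx y hy
        rw [mul_div_cancel₀ _ hδ.ne']
        exact hhB n x hx y hy
    _ ≤ ∑ n ∈ (J ×ˢ J).map (finTwoArrowEquiv ℤ).symm.toEmbedding, (2 * (B (n 1) / δ) + 2) :=
        Finset.sum_le_sum_of_subset_of_nonneg hsub fun n _ _ => by
          have := div_nonneg (hB (n 1)) hδ.le
          positivity
    _ = (J.card : ℝ) * (2 / δ * ∑ j ∈ J, B j + 2 * J.card) := by
        rw [Finset.sum_map, Finset.sum_product]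
        simp only [Equiv.coe_toEmbedding, finTwoArrowEquiv_symm_apply, Matrix.cons_val_one,
          Matrix.cons_val_fin_one, Finset.sum_const, nsmul_eq_mul, Finset.sum_add_distrib]
        congr 1
        rw [mul_comm (J.card : ℝ) 2, Finset.mul_sum]
        congr 1
        exact Finset.sum_congr rfl fun j _ => by ring
    _ ≤ (3 / δ) * (2 / δ * C + 2 * (3 / δ)) := by
        have := hC.nonneg
        have : 0 ≤ ∑ j ∈ J, B j := Finset.sum_nonneg fun j _ => hB j
        gcongr
    _ = _ := by field_simp; ring

theorem HasRowBound.upperBoxDim_le {h : C(Fin 2 → I, ℝ)} {C : ℝ} (hC : HasRowBound h C) :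
    upperBoxDim (graph h) ≤ (2 : ℝ) := by
  have h0 := hC.nonneg
  refine upperBoxDim_le_of fun e he => ⟨Real.log (6 * C + 18), ?_⟩
  filter_upwards [Ioo_mem_nhdsGT (zero_lt_one' ℝ)] with δ hδ
  obtain ⟨hδ, hδ1⟩ := hδ
  have p0 : (0 : ℝ) < boxCount δ (graph h) := by exact_mod_cast one_le_boxCount hδ h
  have hlogδ := Real.log_neg hδ hδ1
  calc Real.log (boxCount δ (graph h))
      ≤ Real.log ((6 * C + 18) * (1 / δ) ^ 2) := Real.log_le_log p0 (hC.boxCount_le hδ hδ1.le)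
    _ = Real.log (6 * C + 18) + 2 * -Real.log δ := by
        rw [Real.log_mul (by positivity) (by positivity), Real.log_pow, one_div, Real.log_inv]
        norm_num
    _ ≤ _ := by nlinarith

/-- A function with a row bound as an element of `C_α[0,1]²`. -/
def HasRowBound.toSurface {h : C(Fin 2 → I, ℝ)} {C : ℝ} (hC : HasRowBound h C) {α : ℝ}
    (hα : 2 ≤ α) : SurfaceSpace α hα :=
  ⟨h, hC.upperBoxDim_le.trans (EReal.coe_le_coe_iff.2 hα)⟩

theorem HasRowBound.toFun_toSurface {h : C(Fin 2 → I, ℝ)} {C : ℝ} (hC : HasRowBound h C) {α : ℝ}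
    (hα : 2 ≤ α) : (hC.toSurface hα).toFun = h := rfl

theorem ceil_inv_le {δ : ℝ} (hδ : 0 < δ) (hδ1 : δ ≤ 1) : ((⌈δ⁻¹⌉₊ : ℕ) : ℝ) ≤ 2 / δ := by
  have h1 : 1 ≤ δ⁻¹ := (one_le_inv₀ hδ).2 hδ1
  have h2 := Nat.ceil_lt_add_one (by positivity : 0 ≤ δ⁻¹)
  rw [div_eq_mul_inv]
  linarith

theorem rangeOn_le {d : ℕ} {f : C(Fin d → I, ℝ)} {S : Set (Fin d → I)} {b : ℝ}
    (hb : ∀ x ∈ S, ∀ y ∈ S, |f x - f y| ≤ b) : rangeOn f S ≤ ENNReal.ofReal b := by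
  refine iSup₂_le fun x hx => iSup₂_le fun y hy => ?_
  rw [Real.enorm_eq_ofReal_abs]
  exact ENNReal.ofReal_le_ofReal (hb x hx y hy)

/-- This gains a factor `δ` over the trivial bound by the sup norm. The gain controls the small
scales in `boxNorm β` for every `β > 2`. -/
theorem HasRowBound.rangeSum_le {h : C(Fin 2 → I, ℝ)} {C δ : ℝ} (hC : HasRowBound h C)
    (hδ : 0 < δ) (hδ1 : δ ≤ 1) : rangeSum δ h ≤ ENNReal.ofReal (2 * C / δ) := by
  obtain ⟨B, hB, hhB, hBs⟩ := hC δ hδ hδ1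
  have hN := ceil_inv_le hδ hδ1
  have hrow : ∑ j : Fin ⌈δ⁻¹⌉₊, B (j : ℕ) ≤ C := by
    refine le_trans ?_ hBs
    have hmap := Finset.sum_map (Finset.range ⌈δ⁻¹⌉₊) (Nat.castEmbedding (R := ℤ)) B
    simp only [Nat.castEmbedding_apply] at hmap
    rw [Fin.sum_univ_eq_sum_range (fun i : ℕ => B (i : ℤ)) ⌈δ⁻¹⌉₊, ← hmap]
    refine Finset.sum_le_sum_of_subset_of_nonneg ?_ fun j _ _ => hB j
    intro j hj
    obtain ⟨i, hi, rfl⟩ := Finset.mem_map.1 hj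
    rw [Finset.mem_range, Nat.lt_ceil] at hi
    rw [Finset.mem_Icc, Int.le_floor, one_div]
    simp only [Nat.castEmbedding_apply, Int.cast_natCast]
    exact ⟨by omega, hi.le⟩
  calc rangeSum δ h ≤ ∑ n : Fin 2 → Fin ⌈δ⁻¹⌉₊, ENNReal.ofReal (B ((n 1 : ℕ) : ℤ)) :=
        Finset.sum_le_sum fun n _ => rangeOn_le fun x hx y hy => hhB _ x hx y hy
    _ = ENNReal.ofReal (∑ n : Fin 2 → Fin ⌈δ⁻¹⌉₊, B ((n 1 : ℕ) : ℤ)) :=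
        (ENNReal.ofReal_sum_of_nonneg fun n _ => hB _).symm
    _ ≤ _ := ENNReal.ofReal_le_ofReal ?_
  rw [Fintype.sum_equiv (finTwoArrowEquiv _)
    (fun n : Fin 2 → Fin ⌈δ⁻¹⌉₊ => B ((n 1 : ℕ) : ℤ))
    (fun p : Fin ⌈δ⁻¹⌉₊ × Fin ⌈δ⁻¹⌉₊ => B ((p.2 : ℕ) : ℤ)) fun n => rfl, Fintype.sum_prod_type]
  simp only [Finset.sum_const, Finset.card_univ, Fintype.card_fin, nsmul_eq_mul]
  calc _ ≤ (2 / δ) * C := by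
        have : 0 ≤ ∑ j : Fin ⌈δ⁻¹⌉₊, B (j : ℕ) := Finset.sum_nonneg fun j _ => hB _
        gcongr
    _ = _ := by ring

/-- The oscillation on a row is at most the increment of `φ` across it, and the increments
telescope. -/
theorem hasRowBound_of_monotone {h : C(Fin 2 → I, ℝ)} {φ : I → ℝ} (hφ : Monotone φ)
    (hh : ∀ p, h p = φ (p 1)) : HasRowBound h (φ 1 - φ 0) := by
  intro δ hδ hδ1
  -- The first and last rows overhang `[0,1]`; extending `φ` by constants makes the overhang
  -- contribute nothing.
  set ψ : ℝ → ℝ := fun t => φ (Set.projIcc 0 1 zero_le_one t) with hψ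
  have hψm : Monotone ψ := hφ.comp (Set.monotone_projIcc _)
  refine ⟨fun j => ψ (((j : ℝ) + 1) * δ) - ψ (j * δ), fun j => ?_, fun n p hp q hq => ?_, ?_⟩
  · exact sub_nonneg.2 (hψm (by nlinarith))
  · have key : ∀ r ∈ gridCell δ n, ψ ((n 1 : ℝ) * δ) ≤ h r ∧ h r ≤ ψ (((n 1 : ℝ) + 1) * δ) := by
      intro r hr
      have hr' : h r = ψ (r 1) := by rw [hh]; simp [hψ]
      rw [hr']
      exact ⟨hψm (hr 1).1, hψm (hr 1).2⟩
    have h1 := key p hp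
    have h2 := key q hq
    rw [abs_le]
    constructor <;> linarith
  · have hsum : ∀ m : ℕ, ∑ j ∈ Finset.Icc (-1) ((m : ℤ) - 1),
        (ψ (((j : ℝ) + 1) * δ) - ψ (j * δ)) = ψ (m * δ) - ψ (-1 * δ) := by
      intro m
      induction m with
      | zero => simp
      | succ m ih =>
        rw [show ((m + 1 : ℕ) : ℤ) - 1 = m by push_cast; ring,
          ← Finset.insert_Icc_sub_one_right_eq_Icc (by omega : (-1 : ℤ) ≤ m),
          Finset.sum_insert (by simp), ih]
        push_cast
        ring
    have hfl0 : 0 ≤ ⌊1 / δ⌋ := Int.floor_nonneg.2 (by positivity)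
    have h1 := hsum (⌊1 / δ⌋ + 1).toNat
    have h2 : (((⌊1 / δ⌋ + 1).toNat : ℕ) : ℤ) - 1 = ⌊1 / δ⌋ := by omega
    rw [h2] at h1
    rw [h1]
    exact sub_le_sub (hφ unitInterval.le_one') (hφ unitInterval.nonneg')

/-! ### Topology of `C_α[0,1]^d` -/

theorem BoxSpace.toFun_add {d : ℕ} {α : ℝ} {hα : (d : ℝ) ≤ α} (f g : BoxSpace d α hα) :
    (f + g).toFun = f.toFun + g.toFun := rfl

theorem BoxSpace.edist_eq {d : ℕ} {α : ℝ} {hα : (d : ℝ) ≤ α} (f g : BoxSpace d α hα) :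
    edist f g = boxEDist α f.toFun g.toFun := rfl

/-- The metric is translation invariant, so addition is Lipschitz. -/
instance {d : ℕ} {α : ℝ} {hα : (d : ℝ) ≤ α} : ContinuousAdd (BoxSpace d α hα) where
  continuous_add := by
    have hl : ∀ f g h : BoxSpace d α hα, edist (f + h) (g + h) = edist f g := fun f g h => by
      simp only [BoxSpace.edist_eq, BoxSpace.toFun_add, boxEDist, add_sub_add_right_eq_sub]
    have hr : ∀ f g h : BoxSpace d α hα, edist (h + f) (h + g) = edist f g := fun f g h => by
      simp only [BoxSpace.edist_eq, BoxSpace.toFun_add, boxEDist, add_sub_add_left_eq_sub]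
    have : LipschitzWith 2 fun p : BoxSpace d α hα × BoxSpace d α hα => p.1 + p.2 := by
      intro p q
      calc edist (p.1 + p.2) (q.1 + q.2)
          ≤ edist (p.1 + p.2) (q.1 + p.2) + edist (q.1 + p.2) (q.1 + q.2) := edist_triangle _ _ _
        _ = edist p.1 q.1 + edist p.2 q.2 := by rw [hl, hr]
        _ ≤ edist p q + edist p q := add_le_add (le_max_left _ _) (le_max_right _ _)
        _ = _ := by rw [← two_mul]; rfl
    exact this.continuous

theorem BoxSpace.continuous_toFun {d : ℕ} {α : ℝ} {hα : (d : ℝ) ≤ α} :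
    Continuous (BoxSpace.toFun : BoxSpace d α hα → C(Fin d → I, ℝ)) := by
  rw [continuous_iff_continuousAt]
  intro f
  rw [ContinuousAt, EMetric.tendsto_nhds]
  intro ε hε
  -- The first term of the metric is capped at `2⁻¹`; below the cap it equals a `boxNorm`, which
  -- dominates the sup norm.
  have h2 : (0 : ℝ≥0∞) < min ε 2⁻¹ := lt_min hε (by simp)
  filter_upwards [Metric.eball_mem_nhds f h2] with g hg
  have h3 : boxEDist α g.toFun f.toFun < min ε 2⁻¹ := hg
  have h4 := (ENNReal.le_tsum 0).trans_lt h3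
  rw [edist_eq_enorm_sub]
  have h5 : ‖g.toFun - f.toFun‖ₑ ≤ boxNorm (α + 1 / (((0 : ℕ) : ℝ) + 1)) (g.toFun - f.toFun) :=
    le_self_add
  rcases min_lt_iff.1 h4 with h6 | h6
  · simp at h6
  · exact h5.trans_lt (h6.trans_le (min_le_left _ _))

theorem rangeSum_le_norm {h : C(Fin 2 → I, ℝ)} {δ : ℝ} (hδ : 0 < δ) (hδ1 : δ ≤ 1) :
    rangeSum δ h ≤ ENNReal.ofReal (8 * ‖h‖ / δ ^ 2) := by
  have hN := ceil_inv_le hδ hδ1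
  calc rangeSum δ h ≤ ∑ n : Fin 2 → Fin ⌈δ⁻¹⌉₊, ENNReal.ofReal (2 * ‖h‖) :=
        Finset.sum_le_sum fun n _ => rangeOn_le fun x _ y _ => by
          have h1 := h.norm_coe_le_norm x
          have h2 := h.norm_coe_le_norm y
          rw [Real.norm_eq_abs] at h1 h2
          have h3 := abs_sub (h x) (h y)
          linarith
    _ = ENNReal.ofReal (∑ n : Fin 2 → Fin ⌈δ⁻¹⌉₊, 2 * ‖h‖) :=
        (ENNReal.ofReal_sum_of_nonneg fun n _ => by positivity).symm
    _ ≤ _ := ENNReal.ofReal_le_ofReal ?_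
  simp only [Finset.sum_const, Finset.card_univ, Fintype.card_pi, Fintype.card_fin,
    Finset.prod_const, nsmul_eq_mul, Nat.cast_pow]
  calc _ ≤ (2 / δ) ^ 2 * (2 * ‖h‖) := by gcongr
    _ = _ := by field_simp; ring

/-- Under a common row bound, uniform convergence suffices. Scales below some `δ₀` contribute at
most `2 * C * δ ^ (β - 2)`, small uniformly in the index because `β > 2`; scales above `δ₀` are
controlled by the sup norm. -/
theorem tendsto_boxNorm {ι : Type*} {l : Filter ι} {h : ι → C(Fin 2 → I, ℝ)} {C β : ℝ}
    (hβ : 2 < β) (hC : ∀ i, HasRowBound (h i) C) (hl : Tendsto h l (𝓝 0)) :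
    Tendsto (fun i => boxNorm β (h i)) l (𝓝 0) := by
  have hn : Tendsto (fun i => ‖h i‖ₑ) l (𝓝 0) := by
    simpa [enorm_eq_nnnorm] using hl.enorm
  have hs : Tendsto (fun i => ⨆ δ ∈ Set.Ioc (0 : ℝ) 1,
      rangeSum δ (h i) / ENNReal.ofReal (δ ^ (1 - β))) l (𝓝 0) := by
    rw [ENNReal.tendsto_nhds_zero]
    intro e he
    obtain ⟨ε, hε, hεe⟩ : ∃ ε : ℝ, 0 < ε ∧ ENNReal.ofReal ε ≤ e := by
      rcases eq_or_ne e ⊤ with rfl | h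
      · exact ⟨1, one_pos, le_top⟩
      · exact ⟨e.toReal, ENNReal.toReal_pos he.ne' h, (ENNReal.ofReal_toReal h).le⟩
    have hp : Tendsto (fun δ : ℝ => 2 * C * δ ^ (β - 2)) (𝓝[>] 0) (𝓝 0) := by
      have h1 : ContinuousAt (fun δ : ℝ => 2 * C * δ ^ (β - 2)) 0 :=
        continuousAt_const.mul (Real.continuousAt_rpow_const _ _ (Or.inr (by linarith)))
      have h2 := h1.tendsto.mono_left (nhdsWithin_le_nhds (s := Set.Ioi 0))
      rwa [Real.zero_rpow (by linarith), mul_zero] at h2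
    obtain ⟨δ₀, hδ₀, hlt⟩ := mem_nhdsGT_iff_exists_Ioo_subset.1 (hp.eventually_le_const hε)
    have hδ₀ : 0 < δ₀ := hδ₀
    have hnn : Tendsto (fun i => ‖h i‖) l (𝓝 0) := by simpa using hl.norm
    filter_upwards [hnn.eventually_le_const (show 0 < ε * δ₀ ^ 2 / 8 by positivity)] with i hi
    refine le_trans (iSup₂_le fun δ hδ => ?_) hεe
    obtain ⟨hδ, hδ1⟩ := hδ
    have hpos : 0 < δ ^ (1 - β) := Real.rpow_pos_of_pos hδ _
    refine ENNReal.div_le_of_le_mul ?_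
    rw [← ENNReal.ofReal_mul hε.le]
    rcases lt_or_ge δ δ₀ with hlt' | hge
    · refine ((hC i).rangeSum_le hδ hδ1).trans (ENNReal.ofReal_le_ofReal ?_)
      have h1 : 2 * C * δ ^ (β - 2) ≤ ε := hlt ⟨hδ, hlt'⟩
      have h2 : δ ^ (β - 2) * δ ^ (1 - β) = δ⁻¹ := by
        rw [← Real.rpow_add hδ, show β - 2 + (1 - β) = -1 by ring, Real.rpow_neg_one]
      calc 2 * C / δ = 2 * C * δ ^ (β - 2) * δ ^ (1 - β) := by
            rw [mul_assoc, h2, div_eq_mul_inv]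
        _ ≤ _ := by gcongr
    · refine (rangeSum_le_norm hδ hδ1).trans (ENNReal.ofReal_le_ofReal ?_)
      have h1 : 1 ≤ δ ^ (1 - β) :=
        Real.one_le_rpow_of_pos_of_le_one_of_nonpos hδ hδ1 (by linarith)
      calc 8 * ‖h i‖ / δ ^ 2 ≤ 8 * (ε * δ₀ ^ 2 / 8) / δ₀ ^ 2 := by gcongr
        _ = ε := by field_simp
        _ ≤ _ := le_mul_of_one_le_right hε.le h1
  simpa [boxNorm] using hn.add hs

/-- Each term of the metric tends to `0` by `tendsto_boxNorm`, as `α + 1 / (k + 1) > 2`. The caps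
`2⁻¹ ^ (k + 1)` justify passing to the limit in the series, by dominated convergence for the
counting measure. -/
theorem continuous_surface {Y : Type*} [TopologicalSpace Y] [FirstCountableTopology Y] {α : ℝ}
    (hα : 2 ≤ α) {g : Y → SurfaceSpace α hα} (hg : Continuous fun y => (g y).toFun) {C : ℝ}
    (hC : ∀ y, HasRowBound (g y).toFun C) : Continuous g := by
  rw [continuous_iff_continuousAt]
  intro y₀
  rw [ContinuousAt, tendsto_iff_edist_tendsto_0]
  have hz : Tendsto (fun y => (g y).toFun - (g y₀).toFun) (𝓝 y₀) (𝓝 0) := by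
    have := (hg.tendsto y₀).sub_const (g y₀).toFun
    rwa [sub_self] at this
  have hlim := tendsto_lintegral_filter_of_dominated_convergence (μ := Measure.count) (l := 𝓝 y₀)
    (F := fun y (k : ℕ) => min ((2 : ℝ≥0∞)⁻¹ ^ (k + 1))
      (boxNorm (α + 1 / ((k : ℝ) + 1)) ((g y).toFun - (g y₀).toFun))) (f := fun _ => 0)
    (fun k => (2 : ℝ≥0∞)⁻¹ ^ (k + 1)) (Eventually.of_forall fun y => measurable_of_countable _)
    (Eventually.of_forall fun y => ae_of_all _ fun k => min_le_left _ _) ?_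
    (ae_of_all _ fun k => ?_)
  · simpa only [lintegral_count, tsum_zero, BoxSpace.edist_eq, boxEDist] using hlim
  · rw [lintegral_count, ENNReal.tsum_geometric_add_one, ENNReal.one_sub_inv_two, inv_inv,
      ENNReal.inv_mul_cancel (by simp) (by simp)]
    exact ENNReal.one_ne_top
  · have hk : (0 : ℝ) < 1 / ((k : ℝ) + 1) := by positivity
    have h1 := tendsto_boxNorm (β := α + 1 / ((k : ℝ) + 1)) (by linarith)
      (fun y => by rw [sub_eq_add_neg]; exact (hC y).add (hC y₀).neg) hz
    have h2 := (tendsto_const_nhds (x := (2 : ℝ≥0∞)⁻¹ ^ (k + 1))).min h1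
    simpa using h2

/-! ### Penalties that force the horizon onto a prescribed row -/

/-- The restriction of `f` to the row at height `y`. -/
def slice (f : C(Fin 2 → I, ℝ)) (y : I) : C(Fin 1 → I, ℝ) where
  toFun x := f ![x 0, y]
  continuous_toFun := by fun_prop

theorem slice_apply (f : C(Fin 2 → I, ℝ)) (y : I) (x : Fin 1 → I) :
    slice f y x = f ![x 0, y] := rfl

theorem slice_add (f g : C(Fin 2 → I, ℝ)) (y : I) : slice (f + g) y = slice f y + slice g y := rfl

theorem horizon_eq_slice {h : C(Fin 2 → I, ℝ)} {y₀ : I}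
    (hmax : ∀ x y, h ![x, y] ≤ h ![x, y₀]) : horizon h = slice h y₀ := by
  ext x
  refine le_antisymm (ciSup_le fun y => hmax _ y) (le_ciSup (f := fun y => h ![x 0, y]) ?_ y₀)
  exact ⟨h ![x 0, y₀], by rintro _ ⟨y, rfl⟩; exact hmax _ y⟩

/-- The modulus is a supremum over the compact set `K × I × I × I` of a jointly continuous function,
which makes it continuous in `t`. Monotonicity and vanishing on `t ≤ 0` are what later split the
penalty into monotone pieces. -/
theorem exists_uniform_modulus {K : Set C(Fin 2 → I, ℝ)} (hK : IsCompact K) (hne : K.Nonempty) :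
    ∃ ω : ℝ → ℝ, Continuous ω ∧ Monotone ω ∧ (∀ t ≤ 0, ω t = 0) ∧
      ∀ f ∈ K, ∀ x y y' : I, f ![x, y] - f ![x, y'] ≤ ω |(y : ℝ) - y'| := by
  -- The vertical shift is `t * u` with `u ∈ [0,1]` free: a shift allowed for `s ≤ t` is allowed for
  -- `t` after rescaling `u` to `s * u / t`, whence monotonicity. The index set of the supremum
  -- thereby stays independent of `t`.
  set F : ℝ → C(Fin 2 → I, ℝ) × I × I × I → ℝ := fun t q =>
    |q.1 ![q.2.1, q.2.2.1] -
      q.1 ![q.2.1, Set.projIcc 0 1 zero_le_one ((q.2.2.1 : ℝ) + max t 0 * (q.2.2.2 : ℝ))]| with hF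
  set S : Set (C(Fin 2 → I, ℝ) × I × I × I) := K ×ˢ Set.univ with hS
  have hScomp : IsCompact S := hK.prod isCompact_univ
  have hSne : S.Nonempty := hne.prod Set.univ_nonempty
  have hFc : Continuous ↿F := by
    have h1 : Continuous fun p : ℝ × C(Fin 2 → I, ℝ) × I × I × I =>
        Set.projIcc (0 : ℝ) 1 zero_le_one ((p.2.2.2.1 : ℝ) + max p.1 0 * (p.2.2.2.2 : ℝ)) :=
      continuous_projIcc.comp (by fun_prop)
    show Continuous fun p : ℝ × C(Fin 2 → I, ℝ) × I × I × I => F p.1 p.2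
    simp only [hF]
    fun_prop
  have hbdd : ∀ t, BddAbove (F t '' S) := fun t =>
    (hScomp.image (hFc.comp (Continuous.prodMk_right t))).bddAbove
  have hval : ∀ t, ∀ f ∈ K, ∀ x y u : I, F t (f, x, y, u) ≤ sSup (F t '' S) :=
    fun t f hf x y u => le_csSup (hbdd t) ⟨_, ⟨hf, trivial⟩, rfl⟩
  have hzero : ∀ t ≤ 0, sSup (F t '' S) = 0 := by
    intro t ht
    have : F t '' S = {0} := by
      rw [Set.eq_singleton_iff_nonempty_unique_mem]
      refine ⟨hSne.image _, ?_⟩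
      rintro _ ⟨q, -, rfl⟩
      simp [hF, max_eq_right ht]
    rw [this, csSup_singleton]
  refine ⟨fun t => sSup (F t '' S), hScomp.continuous_sSup hFc, ?_, hzero, ?_⟩
  · intro s t hst
    refine csSup_le (hSne.image _) ?_
    rintro _ ⟨⟨f, x, y, u⟩, ⟨hf, -⟩, rfl⟩
    rcases le_or_gt t 0 with ht | ht
    · have : F s (f, x, y, u) = F t (f, x, y, u) := by
        simp only [hF, max_eq_right ht, max_eq_right (hst.trans ht)]
      rw [this]
      exact hval t f hf x y u
    · have hm : max s 0 ≤ t := max_le hst ht.le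
      have hm0 : 0 ≤ max s 0 := le_max_right _ _
      have hu : max s 0 * u / t ∈ I := by
        refine ⟨div_nonneg (mul_nonneg hm0 u.2.1) ht.le, (div_le_one ht).2 ?_⟩
        exact (mul_le_of_le_one_right hm0 u.2.2).trans hm
      have : F s (f, x, y, u) = F t (f, x, y, ⟨_, hu⟩) := by
        simp only [hF, max_eq_left ht.le]
        rw [mul_div_cancel₀ _ ht.ne']
      rw [this]
      exact hval t f hf x y _
  · intro f hf x y y'
    have main : ∀ a b : I, a ≤ b → |f ![x, a] - f ![x, b]| ≤ sSup (F ((b : ℝ) - a) '' S) := by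
      intro a b hab
      have hab' : (a : ℝ) ≤ b := hab
      have := hval ((b : ℝ) - a) f hf x a 1
      simpa [hF, max_eq_left (sub_nonneg.2 hab')] using this
    rcases le_total y y' with h | h
    · rw [abs_sub_comm, abs_of_nonneg (sub_nonneg.2 (show (y : ℝ) ≤ y' from h))]
      exact (le_abs_self _).trans (main y y' h)
    · rw [abs_of_nonneg (sub_nonneg.2 (show (y' : ℝ) ≤ y from h))]
      exact (le_abs_self _).trans ((abs_sub_comm _ _).trans_le (main y' y h))

/-- The function `(x, y) ↦ -ω |y - y₀|`. -/
def penalty (ω : C(ℝ, ℝ)) (y₀ : I) : C(Fin 2 → I, ℝ) where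
  toFun p := -ω |(p 1 : ℝ) - y₀|
  continuous_toFun := by fun_prop

theorem continuous_penalty (ω : C(ℝ, ℝ)) : Continuous (penalty ω) := by
  refine ContinuousMap.continuous_of_continuous_uncurry _ ?_
  show Continuous fun p : I × (Fin 2 → I) => -ω |(p.2 1 : ℝ) - p.1|
  fun_prop

theorem HasRowBound.mono {h : C(Fin 2 → I, ℝ)} {C D : ℝ} (hC : HasRowBound h C) (hCD : C ≤ D) :
    HasRowBound h D := fun δ hδ hδ1 =>
  let ⟨B, h1, h2, h3⟩ := hC δ hδ hδ1
  ⟨B, h1, h2, h3.trans hCD⟩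

/-- Since `ω` vanishes on `t ≤ 0`, `ω |y - y₀| = ω (y - y₀) + ω (y₀ - y)`, a sum of two monotone
functions of opposite direction, each of variation at most `ω 1`. The bound does not depend on `y₀`,
as `continuous_surface` requires. -/
theorem hasRowBound_penalty {ω : C(ℝ, ℝ)} (hm : Monotone ω) (h0 : ∀ t ≤ 0, ω t = 0) (y₀ : I) :
    HasRowBound (penalty ω y₀) (2 * ω 1) := by
  let g₁ : C(Fin 2 → I, ℝ) := ⟨fun p => ω ((p 1 : ℝ) - y₀), by fun_prop⟩
  let g₂ : C(Fin 2 → I, ℝ) := ⟨fun p => -ω ((y₀ : ℝ) - p 1), by fun_prop⟩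
  have h1 : HasRowBound g₁ _ := hasRowBound_of_monotone (φ := fun y : I => ω ((y : ℝ) - y₀))
    (fun a b hab => hm (sub_le_sub_right (Subtype.coe_le_coe.2 hab) _)) fun p => rfl
  have h2 : HasRowBound g₂ _ := hasRowBound_of_monotone (φ := fun y : I => -ω ((y₀ : ℝ) - y))
    (fun a b hab => neg_le_neg (hm (sub_le_sub_left (Subtype.coe_le_coe.2 hab) _))) fun p => rfl
  have heq : penalty ω y₀ = -g₁ + g₂ := by
    ext p
    simp only [penalty, g₁, g₂, ContinuousMap.coe_mk, ContinuousMap.add_apply,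
      ContinuousMap.neg_apply]
    rcases le_total ((p 1 : ℝ)) y₀ with h | h
    · rw [abs_sub_comm, abs_of_nonneg (sub_nonneg.2 h), h0 _ (sub_nonpos.2 h)]
      ring
    · rw [abs_of_nonneg (sub_nonneg.2 h), h0 ((y₀ : ℝ) - p 1) (sub_nonpos.2 h)]
      ring
  rw [heq]
  refine (h1.neg.add h2).mono ?_
  have e1 : ω (((1 : I) : ℝ) - y₀) ≤ ω 1 := hm (by simpa using y₀.2.1)
  have e2 : ω (((0 : I) : ℝ) - y₀) = 0 := h0 _ (by simpa using y₀.2.1)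
  have e3 : ω ((y₀ : ℝ) - (1 : I)) = 0 := h0 _ (by simpa using y₀.2.2)
  have e4 : ω ((y₀ : ℝ) - (0 : I)) ≤ ω 1 := hm (by simpa using y₀.2.2)
  simp only [e2, e3]
  linarith

theorem slice_penalty {ω : C(ℝ, ℝ)} (h0 : ∀ t ≤ 0, ω t = 0) (y₀ : I) :
    slice (penalty ω y₀) y₀ = 0 := by
  ext x
  simp [slice, penalty, h0]

theorem add_penalty_le {ω : C(ℝ, ℝ)} (h0 : ∀ t ≤ 0, ω t = 0) {f : C(Fin 2 → I, ℝ)}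
    (hf : ∀ x y y' : I, f ![x, y] - f ![x, y'] ≤ ω |(y : ℝ) - y'|) (y₀ x y : I) :
    (f + penalty ω y₀) ![x, y] ≤ (f + penalty ω y₀) ![x, y₀] := by
  have h1 := hf x y y₀
  simp only [penalty, ContinuousMap.add_apply, ContinuousMap.coe_mk, Matrix.cons_val_one,
    Matrix.cons_val_fin_one, sub_self, abs_zero, h0 0 le_rfl]
  linarith

/-! ### A surface of dimension `2` with a horizon of dimension `2` -/

/-- The distance to the nearest integer. -/
def saw (t : ℝ) : ℝ := ‖(t : UnitAddCircle)‖

theorem saw_eq (t : ℝ) : saw t = |t - round t| := UnitAddCircle.norm_eq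

theorem continuous_saw : Continuous saw := continuous_norm.comp (AddCircle.continuous_mk' 1)

theorem saw_nonneg (t : ℝ) : 0 ≤ saw t := norm_nonneg _

theorem saw_le (t : ℝ) : saw t ≤ 1 / 2 := (saw_eq t).trans_le (abs_sub_round t)

theorem abs_saw_sub_le (s t : ℝ) : |saw s - saw t| ≤ |s - t| := by
  refine (abs_norm_sub_norm_le _ _).trans ?_
  rw [← AddCircle.coe_sub, UnitAddCircle.norm_eq]
  simpa using round_le (s - t) 0

theorem saw_add_int (t : ℝ) (n : ℤ) : saw (t + n) = saw t := by
  rw [saw_eq, saw_eq, round_add_intCast]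
  push_cast
  congr 1
  ring

theorem saw_of_mem {t : ℝ} (h0 : 0 ≤ t) (h1 : t ≤ 1 / 2) : saw t = t := by
  rw [saw, (AddCircle.norm_coe_eq_abs_iff (1 : ℝ) one_ne_zero).2, abs_of_nonneg h0]
  rwa [abs_of_nonneg h0, abs_one]

theorem saw_intCast (n : ℤ) : saw n = 0 := by
  simpa [saw_of_mem] using saw_add_int 0 n

/-- Affinity of `saw` between consecutive half-integers, with slope determined by parity. -/
theorem saw_half_add {i : ℕ} {r : ℝ} (h0 : 0 ≤ r) (h1 : r ≤ 1 / 2) :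
    saw (i / 2 + r) = if Even i then r else 1 / 2 - r := by
  split_ifs with h
  · obtain ⟨k, rfl⟩ := h
    rw [show ((k + k : ℕ) : ℝ) / 2 + r = r + (k : ℤ) by push_cast; ring, saw_add_int,
      saw_of_mem h0 h1]
  · obtain ⟨k, rfl⟩ := Nat.not_even_iff_odd.1 h
    rw [show ((2 * k + 1 : ℕ) : ℝ) / 2 + r = -(1 / 2 - r) + ((k + 1 : ℤ) : ℝ) by push_cast; ring,
      saw_add_int, saw, AddCircle.coe_neg, norm_neg]
    exact saw_of_mem (by linarith) (by linarith)

/-- The hat function of height `1` supported in `(-∞, 1]`. -/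
def ramp (t : ℝ) : ℝ := max 0 (1 - t)

theorem continuous_ramp : Continuous ramp := by unfold ramp; fun_prop

theorem ramp_nonneg (t : ℝ) : 0 ≤ ramp t := le_max_left _ _

theorem ramp_le_one {t : ℝ} (ht : 0 ≤ t) : ramp t ≤ 1 := max_le zero_le_one (by linarith)

theorem ramp_zero : ramp 0 = 1 := by simp [ramp]

theorem ramp_of_one_le {t : ℝ} (ht : 1 ≤ t) : ramp t = 0 := max_eq_left (by linarith)

theorem abs_ramp_sub_le (s t : ℝ) : |ramp s - ramp t| ≤ |s - t| := by
  have h := abs_max_sub_max_le_abs (1 - s) (1 - t) 0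
  rw [max_comm, max_comm (1 - t)] at h
  refine h.trans_eq ?_
  rw [sub_sub_sub_cancel_left, abs_sub_comm]

/-- The weights of the Takagi-type series. -/
def weight (k : ℕ) : ℝ := 1 / ((k : ℝ) + 1) ^ 2

theorem weight_pos (k : ℕ) : 0 < weight k := by unfold weight; positivity

theorem summable_weight : Summable weight := by
  have := (summable_nat_add_iff 1).2 (Real.summable_one_div_nat_pow.2 (one_lt_two))
  refine this.congr fun k => ?_
  simp [weight]

/-- One octave of the surface: teeth of width `2⁻ᵏ` that live on `y ≤ 2⁻ᵏ`. -/
def octave (k : ℕ) (p : Fin 2 → I) : ℝ := saw (2 ^ k * p 0) * ramp (2 ^ k * p 1)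

theorem continuous_octave (k : ℕ) : Continuous (octave k) :=
  (continuous_saw.comp (by fun_prop)).mul (continuous_ramp.comp (by fun_prop))

theorem octave_nonneg (k : ℕ) (p : Fin 2 → I) : 0 ≤ octave k p :=
  mul_nonneg (saw_nonneg _) (ramp_nonneg _)

theorem octave_le (k : ℕ) (p : Fin 2 → I) : octave k p ≤ 1 := by
  have h1 := saw_le (2 ^ k * p 0)
  have h2 := ramp_le_one (t := 2 ^ k * p 1) (mul_nonneg (by positivity) (p 1).2.1)
  exact mul_le_one₀ (h1.trans (by norm_num)) (ramp_nonneg _) h2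

theorem norm_weight_octave_le (k : ℕ) (p : Fin 2 → I) : ‖weight k * octave k p‖ ≤ weight k := by
  rw [Real.norm_eq_abs, abs_of_nonneg (mul_nonneg (weight_pos k).le (octave_nonneg k p))]
  exact mul_le_of_le_one_right (weight_pos k).le (octave_le k p)

theorem summable_weight_octave (p : Fin 2 → I) : Summable fun k => weight k * octave k p :=
  summable_weight.of_norm_bounded fun k => norm_weight_octave_le k p

/-- A surface of dimension `2` whose horizon, the trace on `y = 0`, is a Takagi-type function. -/
def takagiSurface : C(Fin 2 → I, ℝ) where
  toFun p := ∑' k, weight k * octave k p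
  continuous_toFun := continuous_tsum (fun k => continuous_const.mul (continuous_octave k))
    summable_weight norm_weight_octave_le

theorem takagiSurface_apply (p : Fin 2 → I) :
    takagiSurface p = ∑' k, weight k * octave k p := rfl

theorem takagiSurface_le (x y : I) : takagiSurface ![x, y] ≤ takagiSurface ![x, 0] := by
  refine Summable.tsum_le_tsum (fun k => ?_) (summable_weight_octave _) (summable_weight_octave _)
  refine mul_le_mul_of_nonneg_left ?_ (weight_pos k).le
  have h := ramp_le_one (t := 2 ^ k * y) (mul_nonneg (by positivity) y.2.1)
  simpa [octave, ramp_zero] using mul_le_of_le_one_right (saw_nonneg (2 ^ k * x)) h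

/-! ### Row bound for the Takagi surface -/

/-- A bound for the oscillation of an octave on the squares of a row of the `δ`-mesh. -/
def octaveOsc (δ : ℝ) (k : ℕ) (j : ℤ) : ℝ :=
  if (j : ℝ) * δ * 2 ^ k < 1 then min 1 (2 * (2 ^ k * δ)) else 0

theorem octaveOsc_nonneg {δ : ℝ} (hδ : 0 < δ) (k : ℕ) (j : ℤ) : 0 ≤ octaveOsc δ k j := by
  unfold octaveOsc; split_ifs <;> positivity

theorem octaveOsc_le_one {δ : ℝ} (k : ℕ) (j : ℤ) : octaveOsc δ k j ≤ 1 := by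
  unfold octaveOsc
  split_ifs
  · exact min_le_left _ _
  · exact zero_le_one

/-- Both factors take values in `[0,1]` and are `2 ^ k`-Lipschitz in their own coordinate; a cell
whose lower edge is at height at least `2⁻ᵏ` misses the support of the ramp. -/
theorem abs_octave_sub_le {δ : ℝ} (k : ℕ) {n : Fin 2 → ℤ} {p q : Fin 2 → I}
    (hp : p ∈ gridCell δ n) (hq : q ∈ gridCell δ n) :
    |octave k p - octave k q| ≤ octaveOsc δ k (n 1) := by
  unfold octaveOsc
  have h2k : (0 : ℝ) < 2 ^ k := by positivity
  split_ifs with h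
  · refine le_min ?_ ?_
    · have h1 := octave_nonneg k p
      have h2 := octave_nonneg k q
      have h3 := octave_le k p
      have h4 := octave_le k q
      rw [abs_le]
      constructor <;> linarith
    · have hd : ∀ i, |(2 : ℝ) ^ k * p i - 2 ^ k * q i| ≤ 2 ^ k * δ := by
        intro i
        rw [← mul_sub, abs_mul, abs_of_pos h2k]
        refine mul_le_mul_of_nonneg_left ?_ h2k.le
        have h1 := hp i
        have h2 := hq i
        rw [abs_le]
        constructor <;> linarith [h1.1, h1.2, h2.1, h2.2]
      have hs := (abs_saw_sub_le _ _).trans (hd 0)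
      have hr := (abs_ramp_sub_le _ _).trans (hd 1)
      have e : octave k p - octave k q =
          (saw (2 ^ k * p 0) - saw (2 ^ k * q 0)) * ramp (2 ^ k * p 1) +
            saw (2 ^ k * q 0) * (ramp (2 ^ k * p 1) - ramp (2 ^ k * q 1)) := by
        unfold octave; ring
      have hr1 := ramp_le_one (t := 2 ^ k * p 1) (mul_nonneg h2k.le (p 1).2.1)
      have hs1 : saw (2 ^ k * q 0) ≤ 1 := (saw_le _).trans (by norm_num)
      rw [e]
      refine (abs_add_le _ _).trans ?_
      rw [abs_mul, abs_mul, abs_of_nonneg (ramp_nonneg _), abs_of_nonneg (saw_nonneg _)]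
      have h1 := mul_le_of_le_one_right (abs_nonneg (saw (2 ^ k * p 0) - saw (2 ^ k * q 0))) hr1
      have h2 := mul_le_of_le_one_left
        (abs_nonneg (ramp (2 ^ k * p 1) - ramp (2 ^ k * q 1))) hs1
      linarith
  · have hz : ∀ r ∈ gridCell δ n, octave k r = 0 := by
      intro r hr
      have h1 := mul_le_mul_of_nonneg_left (hr 1).1 h2k.le
      rw [octave, ramp_of_one_le (by linarith), mul_zero]
    rw [hz p hp, hz q hq]
    simp

/-- The growth `2 ^ k * δ` of the oscillation is cancelled by the number of rows, about `1 / (2 ^ k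
* δ)`, that meet the support. The result is uniform in `k` and `δ`, so summability of the weights is
all that remains to be used. -/
theorem sum_octaveOsc_le {δ : ℝ} (hδ : 0 < δ) (k : ℕ) (J : Finset ℤ) (hJ : ∀ j ∈ J, -1 ≤ j) :
    ∑ j ∈ J, octaveOsc δ k j ≤ 6 := by
  have h2k : (0 : ℝ) < 2 ^ k := by positivity
  set b : ℝ := min 1 (2 * (2 ^ k * δ)) with hb
  have hb0 : 0 ≤ b := by positivity
  set M : ℤ := ⌊1 / (2 ^ k * δ)⌋ with hM
  have hM0 : 0 ≤ M := Int.floor_nonneg.2 (by positivity)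
  have hMle : (M : ℝ) ≤ 1 / (2 ^ k * δ) := Int.floor_le _
  have hsub : J.filter (fun j : ℤ => (j : ℝ) * δ * 2 ^ k < 1) ⊆ Finset.Icc (-1) M := by
    intro j hj
    rw [Finset.mem_filter] at hj
    rw [Finset.mem_Icc, hM, Int.le_floor, le_div_iff₀ (by positivity)]
    exact ⟨hJ j hj.1, by nlinarith [hj.2]⟩
  have hcard : ((Finset.Icc (-1) M).card : ℝ) = M + 2 := by
    have : ((Finset.Icc (-1) M).card : ℤ) = M + 2 := by rw [Int.card_Icc]; omega
    exact_mod_cast this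
  calc ∑ j ∈ J, octaveOsc δ k j
      = ∑ j ∈ J.filter (fun j : ℤ => (j : ℝ) * δ * 2 ^ k < 1), b := by
        rw [Finset.sum_filter]; rfl
    _ ≤ ∑ j ∈ Finset.Icc (-1) M, b :=
        Finset.sum_le_sum_of_subset_of_nonneg hsub fun _ _ _ => hb0
    _ = (M : ℝ) * b + 2 * b := by rw [Finset.sum_const, nsmul_eq_mul, hcard]; ring
    _ ≤ 1 / (2 ^ k * δ) * (2 * (2 ^ k * δ)) + 2 * 1 := by
        gcongr
        · exact min_le_right _ _
        · exact min_le_left _ _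
    _ ≤ 6 := by
        rw [show 1 / (2 ^ k * δ) * (2 * (2 ^ k * δ)) = 2 by field_simp]
        norm_num

theorem hasRowBound_takagiSurface : HasRowBound takagiSurface (∑' k, weight k * 6) := by
  intro δ hδ _
  have hsum : ∀ j, Summable fun k => weight k * octaveOsc δ k j := fun j =>
    summable_weight.of_nonneg_of_le
      (fun k => mul_nonneg (weight_pos k).le (octaveOsc_nonneg hδ k j))
      fun k => mul_le_of_le_one_right (weight_pos k).le (octaveOsc_le_one k j)
  refine ⟨fun j => ∑' k, weight k * octaveOsc δ k j, fun j => tsum_nonneg fun k =>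
    mul_nonneg (weight_pos k).le (octaveOsc_nonneg hδ k j), fun n p hp q hq => ?_, ?_⟩
  · rw [takagiSurface_apply, takagiSurface_apply,
      ← (summable_weight_octave p).tsum_sub (summable_weight_octave q), ← Real.norm_eq_abs]
    refine tsum_of_norm_bounded (hsum (n 1)).hasSum fun k => ?_
    rw [← mul_sub, norm_mul, Real.norm_of_nonneg (weight_pos k).le, Real.norm_eq_abs]
    exact mul_le_mul_of_nonneg_left (abs_octave_sub_le k hp hq) (weight_pos k).le
  · rw [← Summable.tsum_finsetSum fun j _ => hsum j]
    refine Summable.tsum_le_tsum (fun k => ?_) (summable_sum fun j _ => hsum j)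
      (summable_weight.mul_right 6)
    rw [← Finset.mul_sum]
    exact mul_le_mul_of_nonneg_left
      (sum_octaveOsc_le hδ k _ fun j hj => (Finset.mem_Icc.1 hj).1) (weight_pos k).le

/-! ### Second differences and dimension of the Takagi trace -/

theorem saw_midpoint_lt {m k j : ℕ} (hkm : k < m) :
    saw (2 ^ k * ((j + 1 / 2) / 2 ^ m)) =
      (saw (2 ^ k * (j / 2 ^ m)) + saw (2 ^ k * ((j + 1) / 2 ^ m))) / 2 := by
  -- With `m = k + e + 1`, dilation by `2 ^ k` sends the dyadic interval into `[i / 2, (i + 1) / 2]`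
  -- for `i = j / 2 ^ e`, where `saw` is affine.
  obtain ⟨e, rfl⟩ := Nat.exists_eq_add_of_lt hkm
  have hj : (2 : ℝ) ^ e * (j / 2 ^ e : ℕ) + (j % 2 ^ e : ℕ) = j := by
    exact_mod_cast Nat.div_add_mod j (2 ^ e)
  have hr : ((j % 2 ^ e : ℕ) : ℝ) + 1 ≤ 2 ^ e := by
    exact_mod_cast Nat.mod_lt j (by positivity : 0 < 2 ^ e)
  set i := j / 2 ^ e
  set r : ℝ := ((j % 2 ^ e : ℕ) : ℝ)
  have hr0 : 0 ≤ r := Nat.cast_nonneg _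
  have h2e : (0 : ℝ) < 2 ^ e := by positivity
  have key : ∀ c : ℝ, 0 ≤ c → c ≤ 1 → saw (2 ^ k * ((j + c) / 2 ^ (k + e + 1))) =
      if Even i then (r + c) / (2 * 2 ^ e) else 1 / 2 - (r + c) / (2 * 2 ^ e) := by
    intro c hc0 hc1
    rw [← saw_half_add (i := i) (by positivity)
      (by rw [div_le_iff₀ (by positivity)]; linarith), ← hj]
    congr 1
    rw [pow_add, pow_add]
    field_simp
    ring
  have k0 := key 0 le_rfl zero_le_one
  rw [add_zero] at k0
  rw [k0, key 1 zero_le_one le_rfl, key (1 / 2) (by norm_num) (by norm_num)]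
  split_ifs <;> ring

theorem saw_dyadic {m k : ℕ} (hmk : m ≤ k) (j : ℕ) : saw (2 ^ k * (j / 2 ^ m)) = 0 := by
  obtain ⟨e, rfl⟩ := Nat.exists_eq_add_of_le hmk
  rw [show (2 : ℝ) ^ (m + e) * (j / 2 ^ m) = ((2 ^ e * j : ℤ) : ℝ) by
    push_cast; rw [pow_add]; field_simp]
  exact saw_intCast _

theorem saw_midpoint_gt {m k : ℕ} (hmk : m < k) (j : ℕ) :
    saw (2 ^ k * ((j + 1 / 2) / 2 ^ m)) = 0 := by
  have := saw_dyadic (m := m + 1) (k := k) hmk (2 * j + 1)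
  rw [← this]
  congr 2
  push_cast
  rw [pow_succ]
  field_simp

theorem saw_midpoint_self (m j : ℕ) : saw (2 ^ m * ((j + 1 / 2) / 2 ^ m)) = 1 / 2 := by
  rw [mul_div_cancel₀ _ (by positivity), add_comm]
  have := saw_add_int (1 / 2) j
  rw [Int.cast_natCast] at this
  rw [this, saw_of_mem (by norm_num) le_rfl]

theorem slice_takagiSurface_apply (x : Fin 1 → I) :
    slice takagiSurface 0 x = ∑' k, weight k * saw (2 ^ k * x 0) := by
  simp [slice_apply, takagiSurface_apply, octave, ramp_zero]

/-- The second difference isolates a single octave: coarser ones are affine on the dyadic interval,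
finer ones vanish at all three points, and octave `m` is `0` at the ends and `1 / 2` in the middle.
-/
theorem slice_takagiSurface_midpoint {m j : ℕ} {l c r : Fin 1 → I} (hl : (l 0 : ℝ) = j / 2 ^ m)
    (hc : (c 0 : ℝ) = (j + 1 / 2) / 2 ^ m) (hr : (r 0 : ℝ) = (j + 1) / 2 ^ m) :
    slice takagiSurface 0 c - (slice takagiSurface 0 l + slice takagiSurface 0 r) / 2 =
      weight m / 2 := by
  have hs : ∀ x : I, Summable fun k => weight k * saw (2 ^ k * x) := fun x => by
    simpa [octave, ramp_zero] using summable_weight_octave ![x, 0]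
  rw [slice_takagiSurface_apply, slice_takagiSurface_apply, slice_takagiSurface_apply,
    ← (hs _).tsum_add (hs _), ← tsum_div_const,
    ← (hs _).tsum_sub (((hs _).add (hs _)).div_const 2), tsum_eq_single m, hl, hc, hr]
  · have h1 := saw_dyadic le_rfl (m := m) (j + 1)
    push_cast at h1
    rw [saw_dyadic le_rfl, h1, saw_midpoint_self]
    ring
  · intro k hk
    rw [hl, hc, hr]
    rcases lt_or_gt_of_ne hk with h | h
    · rw [saw_midpoint_lt h]
      ring
    · have h1 := saw_dyadic h.le (j + 1)
      push_cast at h1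
      rw [saw_dyadic h.le, h1, saw_midpoint_gt h]
      ring

/-- The second difference is the mean of the differences from the midpoint to the two ends, hence at
most the oscillation on the cell. -/
theorem weight_le_column {m j : ℕ} (hj : j < 2 ^ m) :
    weight m / 2 ≤ (1 / 2 ^ m) *
      (column (1 / 2 ^ m) (slice takagiSurface 0) fun _ => (j : ℤ)).ncard := by
  have h2 : (0 : ℝ) < 2 ^ m := by positivity
  have hj' : (j : ℝ) + 1 ≤ 2 ^ m := by exact_mod_cast hj
  have hmem : ∀ t : ℝ, 0 ≤ t → t ≤ 1 → (j + t) / 2 ^ m ∈ I := fun t h0 h1 =>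
    ⟨by positivity, (div_le_one h2).2 (by linarith)⟩
  have hcell : ∀ t : ℝ, ∀ (h0 : 0 ≤ t) (h1 : t ≤ 1),
      (fun _ => ⟨_, hmem t h0 h1⟩ : Fin 1 → I) ∈ gridCell (1 / 2 ^ m) fun _ => (j : ℤ) := by
    intro t h0 h1 i
    simp only [Int.cast_natCast]
    constructor
    · rw [mul_one_div]; gcongr; linarith
    · rw [mul_one_div]; gcongr
  have hz := hcell 0 le_rfl zero_le_one
  have ho := hcell 1 zero_le_one le_rfl
  have hh := hcell (1 / 2) (by norm_num) (by norm_num)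
  have h3 := slice_takagiSurface_midpoint (m := m) (j := j)
    (l := fun _ => ⟨_, hmem 0 le_rfl zero_le_one⟩)
    (c := fun _ => ⟨_, hmem (1 / 2) (by norm_num) (by norm_num)⟩)
    (r := fun _ => ⟨_, hmem 1 zero_le_one le_rfl⟩) (by simp) rfl rfl
  have h4 := osc_le_column (by positivity) (slice takagiSurface 0) _ hh hz
  have h5 := osc_le_column (by positivity) (slice takagiSurface 0) _ hh ho
  have h6 := le_of_abs_le h4
  have h7 := le_of_abs_le h5
  linarith

theorem le_boxCount_slice_takagiSurface (m : ℕ) :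
    weight m / 2 * (2 ^ m) ^ 2 ≤ boxCount (1 / 2 ^ m) (graph (slice takagiSurface 0)) := by
  have hδ : (0 : ℝ) < 1 / 2 ^ m := by positivity
  rw [boxCount_eq_sum hδ]
  push_cast
  let ι : ℕ ↪ (Fin 1 → ℤ) := ⟨fun j _ => (j : ℤ), fun a b h => by simpa using congrFun h 0⟩
  have hsub : (Finset.range (2 ^ m)).map ι ⊆ (finite_cells (d := 1) hδ).toFinset := by
    intro n hn
    obtain ⟨j, hj, rfl⟩ := Finset.mem_map.1 hn
    have hj' : (j : ℝ) + 1 ≤ 2 ^ m := by exact_mod_cast Finset.mem_range.1 hj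
    simp only [Set.Finite.mem_toFinset, Set.mem_ofPred_eq]
    refine ⟨fun _ => ⟨j / 2 ^ m, by positivity,
      (div_le_one (by positivity)).2 (by linarith)⟩, fun i => ?_⟩
    show ((j : ℤ) : ℝ) * _ ≤ j / 2 ^ m ∧ (j / 2 ^ m : ℝ) ≤ (((j : ℤ) : ℝ) + 1) * _
    rw [Int.cast_natCast, mul_one_div, mul_one_div]
    exact ⟨le_rfl, by gcongr; linarith⟩
  calc weight m / 2 * (2 ^ m) ^ 2 = ∑ j ∈ Finset.range (2 ^ m), weight m / 2 * 2 ^ m := by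
        rw [Finset.sum_const, Finset.card_range, nsmul_eq_mul]
        push_cast
        ring
    _ ≤ ∑ j ∈ Finset.range (2 ^ m),
        ((column (1 / 2 ^ m) (slice takagiSurface 0) (ι j)).ncard : ℝ) := by
        refine Finset.sum_le_sum fun j hj => ?_
        have := weight_le_column (Finset.mem_range.1 hj)
        rwa [mul_comm (1 / _), mul_one_div, le_div_iff₀ (by positivity)] at this
    _ = ∑ n ∈ (Finset.range (2 ^ m)).map ι,
        ((column (1 / 2 ^ m) (slice takagiSurface 0) n).ncard : ℝ) :=
        by rw [Finset.sum_map]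
    _ ≤ _ := Finset.sum_le_sum_of_subset_of_nonneg hsub fun _ _ _ => Nat.cast_nonneg _

theorem tendsto_half_pow_nhdsGT : Tendsto (fun m : ℕ => (1 : ℝ) / 2 ^ m) atTop (𝓝[>] 0) := by
  refine tendsto_nhdsWithin_iff.2 ⟨?_, Eventually.of_forall fun m => ?_⟩
  · simpa [Function.comp_def] using tendsto_inv_atTop_zero.comp
      (tendsto_pow_atTop_atTop_of_one_lt (one_lt_two (α := ℝ)))
  · exact (by positivity : (0 : ℝ) < 1 / 2 ^ m)

theorem neg_log_half_pow (m : ℕ) : -Real.log (1 / 2 ^ m) = m * Real.log 2 := by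
  rw [one_div, Real.log_inv, neg_neg, Real.log_pow]

theorem two_le_upperBoxDim_slice_takagiSurface :
    2 ≤ upperBoxDim (graph (slice takagiSurface 0)) := by
  refine le_of_forall_lt_imp_le_of_dense fun e he => ?_
  obtain ⟨q, hq1, hq2⟩ := EReal.lt_iff_exists_real_btwn.1 he
  have hq2' : q < 2 := EReal.coe_lt_coe_iff.1 hq2
  refine hq1.le.trans (Filter.le_limsup_of_frequently_le ?_)
  refine tendsto_half_pow_nhdsGT.frequently (Eventually.frequently ?_)
  -- The polynomial loss in `weight m` is beaten by the exponential gap between `2 ^ (q * m)` and `4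
  -- ^ m`.
  have hlim : Tendsto (fun m : ℕ => (((m : ℝ) + 1) ^ 2) / ((2 : ℝ) ^ (2 - q)) ^ m) atTop (𝓝 0) := by
    set r : ℝ := 2 ^ (2 - q)
    have hr : 1 < r := Real.one_lt_rpow one_lt_two (by linarith)
    have h1 := ((tendsto_pow_const_div_const_pow_of_one_lt 2 hr).comp
      (tendsto_add_atTop_nat 1)).const_mul r
    rw [mul_zero] at h1
    refine h1.congr fun m => ?_
    have : r ≠ 0 := by positivity
    simp only [Function.comp_apply, Nat.cast_add, Nat.cast_one, pow_succ r m]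
    field_simp
  have hlog2 := Real.log_pos one_lt_two
  filter_upwards [hlim.eventually_le_const (show (0 : ℝ) < 1 / 2 by norm_num),
    eventually_gt_atTop 0] with m hm hm0
  have hm0' : (0 : ℝ) < m := by exact_mod_cast hm0
  rw [EReal.coe_le_coe_iff, neg_log_half_pow, le_div_iff₀ (by positivity)]
  refine le_trans ?_ (Real.log_le_log (mul_pos (half_pos (weight_pos m)) (by positivity))
    (le_boxCount_slice_takagiSurface m))
  rw [Real.le_log_iff_exp_le (mul_pos (half_pos (weight_pos m)) (by positivity))]
  have h2 : Real.exp (q * (m * Real.log 2)) * ((2 : ℝ) ^ (2 - q)) ^ m = (2 ^ m) ^ 2 := by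
    rw [Real.rpow_def_of_pos two_pos, ← Real.exp_nat_mul, ← Real.exp_add,
      show q * (m * Real.log 2) + m * (Real.log 2 * (2 - q)) = ((m * 2 : ℕ) : ℝ) * Real.log 2 by
        push_cast; ring, Real.exp_nat_mul, Real.exp_log two_pos, pow_mul]
  have h3 : (0 : ℝ) < ((2 : ℝ) ^ (2 - q)) ^ m := by positivity
  rw [div_le_iff₀ h3] at hm
  rw [← h2, weight]
  have h4 : 0 < Real.exp (q * (m * Real.log 2)) := Real.exp_pos _
  rw [div_div, one_div_mul_eq_div, le_div_iff₀ (by positivity)]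
  nlinarith

/-! ### Almost every row of a surface has small dimension -/

theorem volume_row_le (a b : ℝ) :
    volume {y : I | a ≤ y ∧ (y : ℝ) ≤ b} ≤ ENNReal.ofReal (b - a) := by
  rw [unitInterval.volume_apply, ← Real.volume_Icc]
  refine measure_mono ?_
  rintro _ ⟨y, hy, rfl⟩
  exact hy

/-- A Markov inequality over mesh rows: a slice at height `y` meets no more boxes than the graph
does above the row containing `y`, and few rows can carry `T` boxes or more. -/
theorem volume_boxCount_slice_le {δ T : ℝ} (hδ : 0 < δ) (hT : 0 < T) (f : C(Fin 2 → I, ℝ)) :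
    volume {y : I | T ≤ boxCount δ (graph (slice f y))} ≤
      ENNReal.ofReal (δ * boxCount δ (graph f) / T) := by
  classical
  set H := (finite_hitCubes hδ f).toFinset with hH
  set n := ⌈T⌉₊ with hn
  have hn0 : 0 < n := Nat.ceil_pos.2 hT
  set s := H.filter fun m => n ≤ (H.filter fun a => a 1 = m 1).card with hs
  set J : Finset ℤ := s.image fun m => m 1 with hJ
  have hfib : ∀ m ∈ s, s.filter (fun a => a 1 = m 1) = H.filter fun a => a 1 = m 1 := by
    intro m hm
    ext a
    simp only [hs, Finset.mem_filter] at hm ⊢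
    constructor
    · rintro ⟨⟨h1, -⟩, h2⟩; exact ⟨h1, h2⟩
    · rintro ⟨h1, h2⟩; exact ⟨⟨h1, by rw [h2]; exact hm.2⟩, h2⟩
  have hcount : n * J.card ≤ boxCount δ (graph f) := by
    refine (Finset.mul_card_image_le_card s n fun b hb => ?_).trans ?_
    · obtain ⟨m, hm, rfl⟩ := Finset.mem_image.1 hb
      rw [hfib m hm]
      exact (Finset.mem_filter.1 hm).2
    · rw [boxCount, Set.ncard_eq_toFinset_card _ (finite_hitCubes hδ f)]
      exact Finset.card_filter_le _ _
  have hcover : {y : I | T ≤ boxCount δ (graph (slice f y))} ⊆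
      ⋃ j ∈ J, {y : I | (j : ℝ) * δ ≤ y ∧ (y : ℝ) ≤ ((j : ℝ) + 1) * δ} := by
    intro y hy
    have hrow : ((⌊(y : ℝ) / δ⌋ : ℤ) : ℝ) * δ ≤ y ∧
        (y : ℝ) ≤ ((⌊(y : ℝ) / δ⌋ : ℝ) + 1) * δ :=
      ⟨(le_div_iff₀ hδ).1 (Int.floor_le _), (div_le_iff₀ hδ).1 (Int.lt_floor_add_one _).le⟩
    have hny : n ≤ boxCount δ (graph (slice f y)) := Nat.ceil_le.2 hy
    set j : ℤ := ⌊(y : ℝ) / δ⌋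
    have hle : boxCount δ (graph (slice f y)) ≤ (H.filter fun a => a 1 = j).card := by
      rw [boxCount, ← Set.ncard_coe_finset]
      -- Boxes of the slice become boxes of the surface by inserting the row index as middle
      -- coordinate.
      refine Set.ncard_le_ncard_of_injOn (fun m => ![m 0, j, m 1]) ?_ ?_
        (Finset.finite_toSet _)
      · intro m hm
        obtain ⟨x, h1, h2⟩ := mem_hitCubes_graph.1 hm
        simp only [Finset.coe_filter, hH, Set.Finite.mem_toFinset, Set.mem_ofPred_eq]
        refine ⟨mem_hitCubes_graph.2 ⟨![x 0, y], fun i => ?_, h2⟩, rfl⟩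
        fin_cases i
        · exact h1 0
        · exact hrow
      · intro a _ b _ hab
        ext i
        fin_cases i
        · exact congrFun hab 0
        · exact congrFun hab 2
    have hcard := hny.trans hle
    obtain ⟨m, hm⟩ := Finset.card_pos.1 (hn0.trans_le hcard)
    rw [Finset.mem_filter] at hm
    simp only [Set.mem_iUnion]
    refine ⟨j, Finset.mem_image.2 ⟨m, ?_, hm.2⟩, hrow⟩
    rw [hs, Finset.mem_filter, hm.2]
    exact ⟨hm.1, hcard⟩
  calc volume {y : I | T ≤ boxCount δ (graph (slice f y))}
      ≤ ∑ j ∈ J,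
          volume {y : I | (j : ℝ) * δ ≤ y ∧ (y : ℝ) ≤ ((j : ℝ) + 1) * δ} :=
        (measure_mono hcover).trans (measure_biUnion_finset_le _ _)
    _ ≤ ∑ j ∈ J, ENNReal.ofReal δ :=
        Finset.sum_le_sum fun j _ => (volume_row_le _ _).trans_eq (by congr 1; ring)
    _ = ENNReal.ofReal (J.card * δ) := by
        rw [Finset.sum_const, nsmul_eq_mul, ENNReal.ofReal_mul (Nat.cast_nonneg _),
          ENNReal.ofReal_natCast]
    _ ≤ _ := ENNReal.ofReal_le_ofReal ?_
  rw [le_div_iff₀ hT]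
  have h1 : T ≤ n := Nat.le_ceil T
  have h2 : (n : ℝ) * J.card ≤ boxCount δ (graph f) := by exact_mod_cast hcount
  have h3 : (0 : ℝ) ≤ J.card := Nat.cast_nonneg _
  have h4 := mul_le_mul_of_nonneg_right h1 h3
  nlinarith

/-- At scale `2⁻ᵏ` the rows needing at least `2 ^ (k * (b - 1))` boxes have measure at most `2 ^ (-k
* (b - c))`, eventually, for an intermediate `c`. Rows that are bad at all late scales therefore
form a null set; any other row is good at infinitely many scales, which suffices for a lower limit.
-/
theorem ae_lowerBoxDim_slice_le_of_lt {α b : ℝ} {f : C(Fin 2 → I, ℝ)}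
    (hf : upperBoxDim (graph f) ≤ α) (hb : α < b) :
    ∀ᵐ y : I, lowerBoxDim (graph (slice f y)) ≤ ((b - 1 : ℝ) : EReal) := by
  obtain ⟨c, hc, hcb⟩ := exists_between hb
  have hlog2 := Real.log_pos one_lt_two
  set T : ℕ → ℝ := fun k => Real.exp ((b - 1) * (k * Real.log 2)) with hT
  set bad : ℕ → Set I := fun k => {y | T k ≤ boxCount (1 / 2 ^ k) (graph (slice f y))} with hbad
  have hvol : ∀ᶠ k in atTop, volume (bad k) ≤
      ENNReal.ofReal (Real.exp (-((b - c) * Real.log 2)) ^ k) := by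
    filter_upwards [tendsto_half_pow_nhdsGT.eventually (eventually_of_upperBoxDim_le hf hc)]
      with k hk
    have hδ : (0 : ℝ) < 1 / 2 ^ k := by positivity
    refine (volume_boxCount_slice_le hδ (Real.exp_pos _) f).trans (ENNReal.ofReal_le_ofReal ?_)
    have hpos : (0 : ℝ) < boxCount (1 / 2 ^ k) (graph f) := by
      exact_mod_cast one_le_boxCount hδ f
    rw [neg_log_half_pow, Real.log_le_iff_le_exp hpos] at hk
    rw [div_le_iff₀ (Real.exp_pos _), ← Real.exp_nat_mul, ← Real.exp_add]
    have h2 : (1 : ℝ) / 2 ^ k = Real.exp (-(k * Real.log 2)) := by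
      rw [← neg_log_half_pow, neg_neg, Real.exp_log hδ]
    calc 1 / 2 ^ k * (boxCount (1 / 2 ^ k) (graph f) : ℝ)
        ≤ Real.exp (-(k * Real.log 2)) * Real.exp (c * (k * Real.log 2)) := by
          rw [← h2]
          exact mul_le_mul_of_nonneg_left hk hδ.le
      _ = _ := by rw [← Real.exp_add]; congr 1; ring
  have hlim : Tendsto (fun k => volume (bad k)) atTop (𝓝 0) := by
    have h1 : Tendsto (fun k : ℕ => Real.exp (-((b - c) * Real.log 2)) ^ k) atTop (𝓝 0) :=
      tendsto_pow_atTop_nhds_zero_of_lt_one (Real.exp_pos _).le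
        (Real.exp_lt_one_iff.2 (neg_lt_zero.2 (mul_pos (by linarith) hlog2)))
    have h2 := ENNReal.tendsto_ofReal h1
    rw [ENNReal.ofReal_zero] at h2
    exact tendsto_of_tendsto_of_tendsto_of_le_of_le' tendsto_const_nhds h2
      (Eventually.of_forall fun _ => zero_le) hvol
  have hnull : volume (⋃ N, ⋂ k ≥ N, bad k) = 0 := by
    refine measure_iUnion_null fun N => le_antisymm ?_ zero_le
    refine ge_of_tendsto hlim ?_
    filter_upwards [eventually_ge_atTop N] with k hk
    exact measure_mono (Set.iInter₂_subset k hk)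
  refine measure_mono_null ?_ hnull
  intro y hy
  by_contra hne
  simp only [Set.mem_iUnion, Set.mem_iInter, not_exists, not_forall] at hne
  apply hy
  show lowerBoxDim (graph (slice f y)) ≤ _
  unfold lowerBoxDim
  refine Filter.liminf_le_of_frequently_le ?_
  refine tendsto_half_pow_nhdsGT.frequently (frequently_atTop.2 fun N => ?_)
  -- Starting from `N + 1` ensures `k > 0`, so the logarithm in the denominator is not zero.
  obtain ⟨k, hk, hky⟩ := hne (N + 1)
  have hk0 : (0 : ℝ) < k := by exact_mod_cast (Nat.succ_pos N).trans_le hk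
  refine ⟨k, (Nat.le_succ N).trans hk, ?_⟩
  have hpos : (0 : ℝ) < boxCount (1 / 2 ^ k) (graph (slice f y)) := by
    exact_mod_cast one_le_boxCount (by positivity) (slice f y)
  rw [EReal.coe_le_coe_iff, neg_log_half_pow, div_le_iff₀ (by positivity),
    Real.log_le_iff_le_exp hpos]
  exact (not_le.1 hky).le

theorem ae_lowerBoxDim_slice_le {α : ℝ} {f : C(Fin 2 → I, ℝ)} (hf : upperBoxDim (graph f) ≤ α) :
    ∀ᵐ y : I, lowerBoxDim (graph (slice f y)) ≤ ((α - 1 : ℝ) : EReal) := by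
  have h := ae_all_iff.2 fun k : ℕ => ae_lowerBoxDim_slice_le_of_lt hf
    (show α < α + 1 / ((k : ℝ) + 1) by have : (0 : ℝ) < 1 / ((k : ℝ) + 1) := by positivity
                                       linarith)
  filter_upwards [h] with y hy
  have hlim : Tendsto (fun k : ℕ => (((α + 1 / ((k : ℝ) + 1)) - 1 : ℝ) : EReal)) atTop
      (𝓝 ((α - 1 : ℝ) : EReal)) := by
    refine (continuous_coe_real_ereal.tendsto _).comp ?_
    have := (tendsto_one_div_add_atTop_nhds_zero_nat (𝕜 := ℝ)).const_add α |>.sub_const 1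
    rwa [add_zero] at this
  exact ge_of_tendsto hlim (Eventually.of_forall hy)

/-! ### Prevalence -/

/-- The compact set and the measure that witness prevalence, in terms of sums. -/
theorem IsPrevalent.exists_measure {X : Type*} [AddCommGroup X] [TopologicalSpace X]
    [MeasurableSpace X] [BorelSpace X] {F : Set X} (hF : IsPrevalent F) :
    ∃ (μ : Measure X) (K : Set X), IsCompact K ∧ 0 < μ K ∧ μ K < ⊤ ∧
      ∀ x : X, ∀ᵐ f ∂μ, f + x ∈ F := by
  obtain ⟨-, μ, K, hK, h0, h1, h⟩ := hF
  refine ⟨μ, K, hK, h0, h1, fun x => measure_mono_null ?_ (h (-x))⟩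
  rintro f hf ⟨y, hy, rfl⟩
  exact hf (by simpa using hy)

theorem exists_modulus_of_isCompact {α : ℝ} {hα : 2 ≤ α} {K : Set (SurfaceSpace α hα)}
    (hK : IsCompact K) (hne : K.Nonempty) :
    ∃ ω : C(ℝ, ℝ), Monotone ω ∧ (∀ t ≤ 0, ω t = 0) ∧
      ∀ f ∈ K, ∀ x y y' : I, f.toFun ![x, y] - f.toFun ![x, y'] ≤ ω |(y : ℝ) - y'| := by
  obtain ⟨ω, hc, hm, h0, h⟩ := exists_uniform_modulus (hK.image BoxSpace.continuous_toFun)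
    (hne.image _)
  exact ⟨⟨ω, hc⟩, hm, h0, fun f hf => h _ ⟨f, hf, rfl⟩⟩

/-! ### Failure of prevalence -/

theorem not_isPrevalent_setU {α : ℝ} (hα : 2 ≤ α) : ¬ IsPrevalent (setU α hα) := by
  intro hU
  obtain ⟨μ, K, hK, hK0, -, hμ⟩ := hU.exists_measure
  obtain ⟨ω, hm, h0, hω⟩ := exists_modulus_of_isCompact hK (nonempty_of_measure_ne_zero hK0.ne')
  have hp := hasRowBound_penalty hm h0 0
  have hpt := hp.add hasRowBound_takagiSurface
  have hae := (hμ (hp.toSurface hα)).and (hμ (hpt.toSurface hα))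
  obtain ⟨f, hfK, hf1, hf2⟩ : ∃ f ∈ K, f + hp.toSurface hα ∈ setU α hα ∧
      f + hpt.toSurface hα ∈ setU α hα := by
    by_contra! hcon
    have hz := ae_iff.1 hae
    refine hK0.ne' (measure_mono_null ?_ hz)
    intro f hf hff
    exact hcon f hf hff.1 hff.2
  have hmax := fun x y => add_penalty_le h0 (hω f hfK) 0 x y
  have hH1 : horizon (f + hp.toSurface hα).toFun = slice f.toFun 0 := by
    rw [BoxSpace.toFun_add, hp.toFun_toSurface, horizon_eq_slice hmax, slice_add,
      slice_penalty h0, add_zero]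
  have hH2 : horizon (f + hpt.toSurface hα).toFun =
      slice f.toFun 0 + slice takagiSurface 0 := by
    rw [BoxSpace.toFun_add, hpt.toFun_toSurface, ← add_assoc, horizon_eq_slice (y₀ := 0),
      slice_add, slice_add, slice_penalty h0, add_zero]
    · rfl
    · intro x y
      exact add_le_add (hmax x y) (takagiSurface_le x y)
  have hd1 : upperBoxDim (graph (slice f.toFun 0)) < 2 := hH1 ▸ hf1.2.2.2
  have hd2 :
      upperBoxDim (graph (slice f.toFun 0 + slice takagiSurface 0 : C(Fin 1 → I, ℝ))) < 2 := by
    have := hf2.2.2.2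
    rw [hH2] at this
    exact this
  -- One real bound `q < 2` serves both horizons, so their difference, the Takagi trace, inherits
  -- it.
  obtain ⟨q, hq1, hq2⟩ := EReal.lt_iff_exists_real_btwn.1 (max_lt hd1 hd2)
  have hd := upperBoxDim_graph_le_of_osc_le zero_le_one zero_le_one (slice f.toFun 0)
    (slice f.toFun 0 + slice takagiSurface 0) (slice takagiSurface 0) (fun x y => ?_)
    ((le_max_left _ _).trans hq1.le) ((le_max_right _ _).trans hq1.le)
  · exact absurd (two_le_upperBoxDim_slice_takagiSurface.trans hd) (not_le.2 hq2)
  · simp only [ContinuousMap.add_apply, one_mul]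
    rw [abs_sub_comm (slice f.toFun 0 x)]
    refine le_trans (le_of_eq ?_) (abs_add_le _ _)
    congr 1
    ring

theorem not_isPrevalent_setL {α : ℝ} (hα : 2 ≤ α) : ¬ IsPrevalent (setL α hα) := by
  intro hL
  obtain ⟨μ, K, hK, hK0, hKtop, hμ⟩ := hL.exists_measure
  obtain ⟨ω, hm, h0, hω⟩ := exists_modulus_of_isCompact hK (nonempty_of_measure_ne_zero hK0.ne')
  have hp := hasRowBound_penalty hm h0
  set g : I → SurfaceSpace α hα := fun y => (hp y).toSurface hα with hg
  have hgc : Continuous g := continuous_surface hα (continuous_penalty ω) hp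
  have hcont : Continuous fun p : SurfaceSpace α hα × I => p.1 + g p.2 :=
    continuous_fst.add (hgc.comp continuous_snd)
  set S : Set (SurfaceSpace α hα × I) := (fun p => p.1 + g p.2) ⁻¹' setL α hα with hS
  -- The Borel condition in prevalence enters here; second countability of `I` makes a continuous
  -- map on the product measurable for the product σ-algebra.
  have hSm : MeasurableSet S := hcont.measurable hL.1
  have : IsFiniteMeasure (μ.restrict K) := ⟨by simpa using hKtop⟩
  have hnull : ((μ.restrict K).prod volume) S = 0 := by
    rw [Measure.measure_prod_null hSm]
    filter_upwards [ae_restrict_mem hK.measurableSet] with f hfK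
    refine measure_mono_null ?_ (ae_lowerBoxDim_slice_le f.2)
    intro y hy hle
    have hH : horizon (f + g y).toFun = slice f.toFun y := by
      rw [BoxSpace.toFun_add, (hp y).toFun_toSurface,
        horizon_eq_slice fun x z => add_penalty_le h0 (hω f hfK) y x z, slice_add,
        slice_penalty h0, add_zero]
    have hlt := hy.2.1
    simp only at hlt
    rw [hH] at hlt
    exact absurd hle (not_le.2 hlt)
  rw [Measure.prod_apply_symm hSm] at hnull
  -- In the other order of integration every section is full, so the product measure of `S` is `μ K
  -- > 0`.
  have hfull : ∀ y, (μ.restrict K) ((fun f => (f, y)) ⁻¹' S) = μ K := by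
    intro y
    rw [← Measure.restrict_apply_univ K]
    exact measure_congr (eventuallyEq_univ.2 (ae_restrict_of_ae (hμ (g y))))
  simp only [hfull, lintegral_const, measure_univ, mul_one] at hnull
  exact hK0.ne' hnull

end Horizon

end

theorem theorem1p3 (α : ℝ) (hα : 2 ≤ α) (hα' : α < 3) :
    ¬ Horizon.IsPrevalent (Horizon.setU α hα) ∧ ¬ Horizon.IsPrevalent (Horizon.setL α hα) :=
  ⟨Horizon.not_isPrevalent_setU hα, Horizon.not_isPrevalent_setL hα⟩
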